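/- Let $M$ be a smooth manifold of dimension $n\ge 1$ and let $F$ be a Finsler structure on $M$: a smooth function $F: TM\setminus 0\to(0,\infty)$ with $F(x,\lambda y)=\lambda F(x,y)$ for $\lambda>0$ whose fundamental tensor $g_{ij}=\tfrac12[F^2]_{y^iy^j}$ is positive definite on $TM\setminus 0$. Let $\pi: SM=(TM\setminus 0)/\mathbb{R}^+\to M$ be the projective sphere bundle. Put $G^i=\tfrac14 g^{ij}\big([F^2]_{y^jx^k}y^k-[F^2]_{x^j}\big)$ and $\delta y^i=\tfrac1F\big(dy^i+\tfrac{\partial G^i}{\partial y^j}dx^j\big)$, and let $$g^{T(SM)}=g_{ij}\,dx^i\otimes dx^j+\big(g_{ij}-F_{y^i}F_{y^j}\big)\,\delta y^i\otimes\delta y^j$$ be the Sasaki-type Riemannian metric on $SM$ (the right-hand side is a tensor on $TM\setminus 0$ that descends to $SM$). Let $\mathcal F=V(SM)=\ker d\pi\subset T(SM)$. For a Riemannian metric $h=\langle\cdot,\cdot\rangle$ on $SM$ let $\mathcal F^\perp$ be the $h$-orthogonal complement of $\mathcal F$, $p^\perp: T(SM)\to\mathcal F^\perp$ the orthogonal projection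 and $\nabla$ the Levi-Civita connection of $h$. The Bott connection $\widetilde\nabla$ on $\mathcal F^\perp$ is given by $\widetilde\nabla_XU=p^\perp[X,U]$ for $X\in\Gamma(\mathcal F)$ and $\widetilde\nabla_XU=p^\perp\nabla_XU$ for $X\in\Gamma(\mathcal F^\perp)$, where $U\in\Gamma(\mathcal F^\perp)$. Its dual connection $\widetilde\nabla^{*}$ is given by $d\langle U,W\rangle=\langle\widetilde\nabla U,W\rangle+\langle U,\widetilde\nabla^{*}W\rangle$ for $U,W\in\Gamma(\mathcal F^\perp)$. The Cartan endomorphism associated with $h$ is the $\mathrm{End}(\mathcal F^\perp)$-valued one-form $\tfrac12(\widetilde\nabla^{*}-\widetilde\nabla)$ on $SM$. Let $\sigma=\pi^*s$ with $s\in C^\infty(M)$, let $H$ be the Cartan endomorphism associated with $g^{T(SM)}$ and let $\bar H$ be the Cartan endomorphism associated with $\bar g^{T(SM)}=e^{2\sigma}g^{T(SM)}$. Then $$\bar H=H .$$ -/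

import Mathlib

open Set Topology
open scoped Manifold ContDiff

noncomputable section

/-- The model space of an `(m+1)`-dimensional manifold. -/
abbrev BaseModel (m : ℕ) : Type := EuclideanSpace ℝ (Fin (m + 1))

/-- The model space of the `(2m+1)`-dimensional sphere bundle. -/
abbrev SphereModel (m : ℕ) : Type := EuclideanSpace ℝ (Fin (m + 1)) × EuclideanSpace ℝ (Fin m)

section TangentCoordinates

variable {m : ℕ} {M : Type*} [TopologicalSpace M] [ChartedSpace (BaseModel m) M]
  [IsManifold (𝓡 (m + 1)) ∞ M]

/-- The natural local coordinates `(x, y)` on `TM` induced by the local coordinates `x` of `M`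
around `x₀`. -/
def tangentCoord (x₀ : M) :
    OpenPartialHomeomorph (TangentBundle (𝓡 (m + 1)) M) (BaseModel m × BaseModel m) :=
  chartAt (ModelProd (BaseModel m) (BaseModel m)) (⟨x₀, 0⟩ : TangentBundle (𝓡 (m + 1)) M)

theorem mem_tangentCoord_source (x₀ : M) (v : TangentBundle (𝓡 (m + 1)) M) :
    v ∈ (tangentCoord x₀).source ↔ v.proj ∈ (chartAt (BaseModel m) x₀).source :=
  TangentBundle.mem_chart_source_iff v ⟨x₀, 0⟩

theorem tangentCoord_smul (x₀ : M) (x : M) (c : ℝ) (u : TangentSpace (𝓡 (m + 1)) x) :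
    tangentCoord x₀ (⟨x, c • u⟩ : TangentBundle (𝓡 (m + 1)) M) =
      ((tangentCoord x₀ (⟨x, u⟩ : TangentBundle (𝓡 (m + 1)) M)).1,
        c • (tangentCoord x₀ (⟨x, u⟩ : TangentBundle (𝓡 (m + 1)) M)).2) := by
  refine Prod.ext rfl ?_
  exact ((tangentBundleCore (𝓡 (m + 1)) M).coordChange (achart _ x) (achart _ x₀) x).map_smul c u

theorem tangentCoord_snd_ne_zero (x₀ : M) {v : TangentBundle (𝓡 (m + 1)) M}
    (hv : v ∈ (tangentCoord x₀).source) : (tangentCoord x₀ v).2 ≠ 0 ↔ v.2 ≠ 0 := by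
  obtain ⟨x, u⟩ := v
  refine not_congr ⟨fun h => ?_, fun h => ?_⟩
  · have h2 : tangentCoord x₀ (⟨x, (2 : ℝ) • u⟩ : TangentBundle (𝓡 (m + 1)) M)
        = tangentCoord x₀ ⟨x, u⟩ := by
      rw [tangentCoord_smul]
      refine Prod.ext rfl ?_
      simp [h]
    have h3 := (tangentCoord x₀).injOn
      (by rw [mem_tangentCoord_source] at hv ⊢; exact hv) hv h2
    have h4 : (2 : ℝ) • u = u := by simpa using h3
    rw [two_smul] at h4
    simpa using h4
  · have h0 : u = 0 := h
    subst h0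
    have h1 := tangentCoord_smul x₀ x 0 (0 : TangentSpace (𝓡 (m + 1)) x)
    rw [zero_smul, zero_smul] at h1
    exact congrArg Prod.snd h1

end TangentCoordinates

section SphereBundle

variable (m : ℕ) (M : Type*) [TopologicalSpace M] [ChartedSpace (BaseModel m) M]
  [IsManifold (𝓡 (m + 1)) ∞ M]

/-- The slit tangent bundle `TM₀ = TM \ 0`. -/
abbrev SlitTangent : Type _ := {v : TangentBundle (𝓡 (m + 1)) M // v.2 ≠ 0}

/-- Two nonzero tangent vectors are equivalent if they lie on the same ray. -/
def raySetoid : Setoid (SlitTangent m M) where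
  r v w := ∃ c : ℝ, 0 < c ∧ w.1 = ⟨v.1.proj, c • v.1.2⟩
  iseqv :=
    { refl := fun v => ⟨1, one_pos, by rw [one_smul]⟩
      symm := by
        rintro ⟨⟨x, u⟩, hu⟩ ⟨w, hw⟩ ⟨c, hc, rfl⟩
        exact ⟨c⁻¹, inv_pos.2 hc, by simp [smul_smul, inv_mul_cancel₀ hc.ne']⟩
      trans := by
        rintro ⟨⟨x, u⟩, hu⟩ ⟨w, hw⟩ ⟨z, hz⟩ ⟨c, hc, rfl⟩ ⟨d, hd, rfl⟩
        exact ⟨d * c, mul_pos hd hc, by simp [smul_smul]⟩ }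

/-- The projective sphere bundle `SM = TM₀ / ℝ⁺`. -/
def SphereBundle : Type _ := Quotient (raySetoid m M)

/-- `SM` carries the quotient topology. -/
instance : TopologicalSpace (SphereBundle m M) :=
  inferInstanceAs (TopologicalSpace (Quotient (raySetoid m M)))

variable {m M}

namespace SphereBundle

/-- The ray `[v]` of a nonzero tangent vector `v`. -/
def mk (v : SlitTangent m M) : SphereBundle m M := Quotient.mk (raySetoid m M) v

theorem isQuotientMap_mk : IsQuotientMap (mk : SlitTangent m M → SphereBundle m M) :=
  isQuotientMap_quot_mk

/-- The projection `π : SM → M`. -/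
def proj : SphereBundle m M → M :=
  Quotient.lift (fun v : SlitTangent m M => v.1.proj) (by
    rintro ⟨⟨x, u⟩, hu⟩ ⟨w, hw⟩ ⟨c, hc, rfl⟩; rfl)

/-- The local coordinates on `SM` around `x₀` attached to a linear isomorphism
`L : ℝ^(m+1) ≃ ℝ × ℝ^m`: the ray of `(x, y)` with `L y = (t, z)`, `t > 0`, has the coordinates
`(x, t⁻¹ z)`. -/
def coordFun (x₀ : M) (L : BaseModel m ≃L[ℝ] ℝ × EuclideanSpace ℝ (Fin m)) :
    SphereBundle m M → SphereModel m :=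
  Quotient.lift (fun v : SlitTangent m M =>
    ((tangentCoord x₀ v.1).1,
      (L (tangentCoord x₀ v.1).2).1⁻¹ • (L (tangentCoord x₀ v.1).2).2)) (by
    rintro ⟨⟨x, u⟩, hu⟩ ⟨w, hw⟩ ⟨c, hc, rfl⟩
    simp only [tangentCoord_smul, map_smul, Prod.smul_fst, Prod.smul_snd, smul_smul, smul_eq_mul,
      mul_inv_rev]
    rw [mul_assoc, inv_mul_cancel₀ hc.ne', mul_one])

/-- The domain of `coordFun`. -/
def coordSource (x₀ : M) (L : BaseModel m ≃L[ℝ] ℝ × EuclideanSpace ℝ (Fin m)) :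
    Set (SphereBundle m M) :=
  {p | Quotient.lift (fun v : SlitTangent m M =>
    v.1 ∈ (tangentCoord x₀).source ∧ 0 < (L (tangentCoord x₀ v.1).2).1) (by
    rintro ⟨⟨x, u⟩, hu⟩ ⟨w, hw⟩ ⟨c, hc, rfl⟩
    simp only [mem_tangentCoord_source, tangentCoord_smul, map_smul, Prod.smul_fst, smul_eq_mul,
      hc, mul_pos_iff_of_pos_left]) p}

open Classical in
/-- The inverse of `coordFun`: `(x, z)` is sent to the ray of `(x, L⁻¹ (1, z))`. -/
def coordInv (x₀ : M) (L : BaseModel m ≃L[ℝ] ℝ × EuclideanSpace ℝ (Fin m)) (w : SphereModel m) :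
    SphereBundle m M :=
  if h : ((tangentCoord x₀).symm (w.1, L.symm (1, w.2))).2 ≠ 0 then mk ⟨_, h⟩
  else mk ⟨⟨x₀, L.symm (1, 0)⟩, fun h0 => by
    have h1 : (L.symm (1, 0) : BaseModel m) = 0 := h0
    simp at h1⟩

theorem symm_one_ne_zero (L : BaseModel m ≃L[ℝ] ℝ × EuclideanSpace ℝ (Fin m))
    (z : EuclideanSpace ℝ (Fin m)) : L.symm (1, z) ≠ 0 := by
  intro h
  have := congrArg L h
  simp at this

theorem coord_symm_ne_zero (x₀ : M) {w : BaseModel m × BaseModel m}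
    (hw : w ∈ (tangentCoord x₀).target) (h0 : w.2 ≠ 0) :
    ((tangentCoord x₀).symm w).2 ≠ 0 := by
  rw [← tangentCoord_snd_ne_zero x₀ ((tangentCoord x₀).map_target hw),
    (tangentCoord x₀).right_inv hw]
  exact h0

theorem mem_target_of_fst (x₀ : M) {w w' : BaseModel m × BaseModel m} (h : w.1 = w'.1)
    (hw : w ∈ (tangentCoord x₀).target) : w' ∈ (tangentCoord x₀).target := by
  have h1 := (TangentBundle.mem_chart_target_iff w ⟨x₀, 0⟩).1 hw
  refine (TangentBundle.mem_chart_target_iff w' ⟨x₀, 0⟩).2 ?_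
  rwa [← h]

/-- The chart of `SM` given by `coordFun`. -/
def coordChart (x₀ : M) (L : BaseModel m ≃L[ℝ] ℝ × EuclideanSpace ℝ (Fin m)) :
    OpenPartialHomeomorph (SphereBundle m M) (SphereModel m) where
  toFun := coordFun x₀ L
  invFun := coordInv x₀ L
  source := coordSource x₀ L
  target := {w | (w.1, L.symm (1, w.2)) ∈ (tangentCoord x₀).target}
  map_source' := by
    rintro ⟨v⟩ ⟨h1, h2⟩
    exact mem_target_of_fst x₀ rfl ((tangentCoord x₀).map_source h1)
  map_target' := by
    intro w hw
    have hw' : (w.1, L.symm (1, w.2)) ∈ (tangentCoord x₀).target := hw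
    have h := coord_symm_ne_zero x₀ hw' (symm_one_ne_zero L w.2)
    rw [coordInv, dif_pos h]
    refine ⟨(tangentCoord x₀).map_target hw', ?_⟩
    simp only [(tangentCoord x₀).right_inv hw']
    simp
  left_inv' := by
    rintro ⟨v, hv⟩ ⟨h1, h2⟩
    have h1' : v ∈ (tangentCoord x₀).source := h1
    have h2' : 0 < (L (tangentCoord x₀ v).2).1 := h2
    set t := (L (tangentCoord x₀ v).2).1 with ht
    have key : tangentCoord x₀ (⟨v.proj, t⁻¹ • v.2⟩ : TangentBundle (𝓡 (m + 1)) M) =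
        ((tangentCoord x₀ v).1, L.symm (1, t⁻¹ • (L (tangentCoord x₀ v).2).2)) := by
      rw [tangentCoord_smul]
      refine Prod.ext rfl ?_
      apply L.injective
      rw [map_smul, L.apply_symm_apply]
      refine Prod.ext ?_ rfl
      exact inv_mul_cancel₀ h2'.ne'
    have key2 : (tangentCoord x₀).symm
        ((tangentCoord x₀ v).1, L.symm (1, t⁻¹ • (L (tangentCoord x₀ v).2).2)) =
        ⟨v.proj, t⁻¹ • v.2⟩ := by
      rw [← key]
      apply (tangentCoord x₀).left_inv
      rw [mem_tangentCoord_source] at h1' ⊢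
      exact h1'
    have hne : ((tangentCoord x₀).symm
        ((tangentCoord x₀ v).1, L.symm (1, t⁻¹ • (L (tangentCoord x₀ v).2).2))).2 ≠ 0 := by
      rw [key2]
      exact smul_ne_zero (inv_ne_zero h2'.ne') hv
    change coordInv x₀ L ((tangentCoord x₀ v).1, t⁻¹ • (L (tangentCoord x₀ v).2).2) = _
    rw [coordInv, dif_pos hne]
    apply Quotient.sound
    refine ⟨t, h2', ?_⟩
    refine Eq.trans ?_ (congrArg (fun u : TangentBundle (𝓡 (m + 1)) M =>
      (⟨u.proj, t • u.2⟩ : TangentBundle (𝓡 (m + 1)) M)) key2).symm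
    simp [smul_smul, mul_inv_cancel₀ h2'.ne']
  right_inv' := by
    intro w hw
    have hw' : (w.1, L.symm (1, w.2)) ∈ (tangentCoord x₀).target := hw
    have h := coord_symm_ne_zero x₀ hw' (symm_one_ne_zero L w.2)
    rw [coordInv, dif_pos h]
    simp only [coordFun, mk, Quotient.lift_mk, (tangentCoord x₀).right_inv hw']
    simp
  open_source := by
    rw [← isQuotientMap_mk.isOpen_preimage]
    have h1 : IsOpen ((tangentCoord x₀).source ∩
        (tangentCoord x₀) ⁻¹' {w : BaseModel m × BaseModel m | 0 < (L w.2).1}) :=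
      (tangentCoord x₀).isOpen_inter_preimage
        (isOpen_lt continuous_const (by fun_prop))
    exact h1.preimage continuous_subtype_val
  open_target := by
    exact (tangentCoord x₀).open_target.preimage (by fun_prop)
  continuousOn_toFun := by
    have ho : IsOpen (coordSource x₀ L) := by
      rw [← isQuotientMap_mk.isOpen_preimage]
      have h1 : IsOpen ((tangentCoord x₀).source ∩
          (tangentCoord x₀) ⁻¹' {w : BaseModel m × BaseModel m | 0 < (L w.2).1}) :=
        (tangentCoord x₀).isOpen_inter_preimage
          (isOpen_lt continuous_const (by fun_prop))
      exact h1.preimage continuous_subtype_val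
    rw [isQuotientMap_mk.continuousOn_isOpen_iff ho]
    have hT : ContinuousOn (fun v : SlitTangent m M => tangentCoord x₀ v.1)
        (mk ⁻¹' coordSource x₀ L) :=
      (tangentCoord x₀).continuousOn.comp continuous_subtype_val.continuousOn
        (fun v hv => hv.1)
    have hT1 : ContinuousOn (fun v : SlitTangent m M => (tangentCoord x₀ v.1).1)
        (mk ⁻¹' coordSource x₀ L) := continuous_fst.comp_continuousOn hT
    have hL1 : ContinuousOn (fun v : SlitTangent m M => (L (tangentCoord x₀ v.1).2).1)
        (mk ⁻¹' coordSource x₀ L) :=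
      (show Continuous fun w : BaseModel m × BaseModel m => (L w.2).1 by
        fun_prop).comp_continuousOn hT
    have hL2 : ContinuousOn (fun v : SlitTangent m M => (L (tangentCoord x₀ v.1).2).2)
        (mk ⁻¹' coordSource x₀ L) :=
      (show Continuous fun w : BaseModel m × BaseModel m => (L w.2).2 by
        fun_prop).comp_continuousOn hT
    exact hT1.prodMk ((hL1.inv₀ (fun v hv => ne_of_gt hv.2)).smul hL2)
  continuousOn_invFun := by
    rw [continuousOn_iff_continuous_domRestrict]
    have hne : ∀ w : {w : SphereModel m | (w.1, L.symm (1, w.2)) ∈ (tangentCoord x₀).target},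
        ((tangentCoord x₀).symm (w.1.1, L.symm (1, w.1.2))).2 ≠ 0 := fun w =>
      coord_symm_ne_zero x₀ w.2 (symm_one_ne_zero L w.1.2)
    have hc : Continuous
        (fun w : {w : SphereModel m | (w.1, L.symm (1, w.2)) ∈ (tangentCoord x₀).target} =>
          (tangentCoord x₀).symm (w.1.1, L.symm (1, w.1.2))) := by
      refine (tangentCoord x₀).continuousOn_symm.comp_continuous (by fun_prop) (fun w => w.2)
    have h2 := isQuotientMap_mk.continuous.comp (hc.subtype_mk hne)
    refine h2.congr fun w => ?_
    simp only [Function.comp, Set.domRestrict_apply, coordInv]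
    rw [dif_pos (hne w)]

theorem exists_coordChart (p : SphereBundle m M) :
    ∃ (x₀ : M) (L : BaseModel m ≃L[ℝ] ℝ × EuclideanSpace ℝ (Fin m)),
      p ∈ (coordChart x₀ L).source := by
  obtain ⟨v, hv⟩ := p
  have hs : v ∈ (tangentCoord v.proj).source := by
    rw [mem_tangentCoord_source]; exact mem_chart_source _ _
  have hy := (tangentCoord_snd_ne_zero v.proj hs).2 hv
  let L₀ : BaseModel m ≃L[ℝ] ℝ × EuclideanSpace ℝ (Fin m) :=
    ContinuousLinearEquiv.ofFinrankEq (by simp [add_comm])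
  obtain ⟨A, hA⟩ := SeparatingDual.exists_continuousLinearEquiv_apply_eq (R := ℝ) hy
    (symm_one_ne_zero L₀ 0)
  refine ⟨v.proj, A.trans L₀, hs, ?_⟩
  simp [hA]

/-- The smooth atlas of `SM`. -/
instance : ChartedSpace (SphereModel m) (SphereBundle m M) where
  atlas := {e | ∃ x₀ L, e = coordChart x₀ L}
  chartAt p := coordChart (exists_coordChart p).choose (exists_coordChart p).choose_spec.choose
  mem_chart_source p := (exists_coordChart p).choose_spec.choose_spec
  chart_mem_atlas _ := ⟨_, _, rfl⟩

theorem contDiffOn_tangentCoord (x₀ x₁ : M) :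
    ContDiffOn ℝ ∞ (fun w : BaseModel m × BaseModel m =>
        tangentCoord x₁ ((tangentCoord x₀).symm w))
      ((tangentCoord x₀).symm.trans (tangentCoord x₁)).source := by
  have : IsManifold (𝓡 (m + 1)) (∞ + 1) M :=
    inferInstanceAs (IsManifold (𝓡 (m + 1)) ∞ M)
  have h := contDiffOn_ext_coord_change (n := ∞) (I := (𝓡 (m + 1)).tangent)
    (⟨x₁, 0⟩ : TangentBundle (𝓡 (m + 1)) M) ⟨x₀, 0⟩
  refine h.congr_mono (fun w _ => rfl) ?_
  intro w hw
  rw [ext_coord_change_source]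
  exact ⟨w, hw, rfl⟩

instance : IsManifold 𝓘(ℝ, SphereModel m) ∞ (SphereBundle m M) := by
  refine isManifold_of_contDiffOn _ _ _ ?_
  rintro _ _ ⟨x₀, L, rfl⟩ ⟨x₁, L', rfl⟩
  simp only [modelWithCornersSelf_coe, modelWithCornersSelf_coe_symm, Set.range_id,
    Set.inter_univ, Function.id_comp, Function.comp_id, Set.preimage_id]
  set s := ((coordChart x₀ L).symm.trans (coordChart x₁ L')).source with hs
  have hval : ∀ w ∈ s, ∃ h : ((tangentCoord x₀).symm (w.1, L.symm (1, w.2))).2 ≠ 0,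
      (coordChart x₀ L).symm w = mk ⟨_, h⟩ := by
    intro w hw
    have hw' : (w.1, L.symm (1, w.2)) ∈ (tangentCoord x₀).target := hw.1
    have h := coord_symm_ne_zero x₀ hw' (symm_one_ne_zero L w.2)
    refine ⟨h, ?_⟩
    change coordInv x₀ L w = _
    rw [coordInv, dif_pos h]
  have hmem : ∀ w ∈ s, (w.1, L.symm (1, w.2)) ∈
      ((tangentCoord x₀).symm.trans (tangentCoord x₁)).source ∧
      0 < (L' (tangentCoord x₁ ((tangentCoord x₀).symm (w.1, L.symm (1, w.2)))).2).1 := by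
    intro w hw
    obtain ⟨h, he⟩ := hval w hw
    have h2 : (coordChart x₀ L).symm w ∈ coordSource x₁ L' := hw.2
    rw [he] at h2
    exact ⟨⟨hw.1, h2.1⟩, h2.2⟩
  have hT : ContDiffOn ℝ ∞ (fun w : SphereModel m =>
      tangentCoord x₁ ((tangentCoord x₀).symm (w.1, L.symm (1, w.2)))) s :=
    (contDiffOn_tangentCoord x₀ x₁).comp
      (f := fun w : SphereModel m => ((w.1, L.symm (1, w.2)) : BaseModel m × BaseModel m))
      (by fun_prop) (fun w hw => (hmem w hw).1)
  have hL : ContDiffOn ℝ ∞ (fun w : SphereModel m =>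
      L' (tangentCoord x₁ ((tangentCoord x₀).symm (w.1, L.symm (1, w.2)))).2) s :=
    L'.contDiff.comp_contDiffOn hT.snd
  have hmain : ContDiffOn ℝ ∞ (fun w : SphereModel m =>
      ((tangentCoord x₁ ((tangentCoord x₀).symm (w.1, L.symm (1, w.2)))).1,
        (L' (tangentCoord x₁ ((tangentCoord x₀).symm (w.1, L.symm (1, w.2)))).2).1⁻¹ •
        (L' (tangentCoord x₁ ((tangentCoord x₀).symm (w.1, L.symm (1, w.2)))).2).2)) s :=
    hT.fst.prodMk ((hL.fst.inv (fun w hw => (hmem w hw).2.ne')).smul hL.snd)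
  refine hmain.congr fun w hw => ?_
  obtain ⟨h, he⟩ := hval w hw
  change coordFun x₁ L' ((coordChart x₀ L).symm w) = _
  rw [he]
  rfl

/-- The vertical tangent bundle `V(SM) = ker dπ`, tangent to the projective spheres. -/
def vertical (p : SphereBundle m M) :
    Submodule ℝ (TangentSpace 𝓘(ℝ, SphereModel m) p) :=
  LinearMap.ker (mfderiv 𝓘(ℝ, SphereModel m) (𝓡 (m + 1)) (proj : SphereBundle m M → M) p).toLinearMap

end SphereBundle

end SphereBundle

section Finsler

variable {m : ℕ}

/-- `g_ij = ½ [F²]_{yⁱ yʲ}`, for a function `f = F` of the local coordinates `(x, y)`, as the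
bilinear form `(u, v) ↦ g_ij uⁱ vʲ`. -/
def fundamentalTensor (f : BaseModel m → BaseModel m → ℝ) (x y : BaseModel m) :
    BaseModel m →L[ℝ] BaseModel m →L[ℝ] ℝ :=
  (1 / 2 : ℝ) • fderiv ℝ (fun w => fderiv ℝ (fun w' => f x w' ^ 2) w) y

/-- The covector `[F²]_{yʲ xᵏ} yᵏ - [F²]_{xʲ}`. -/
def sprayCovector (f : BaseModel m → BaseModel m → ℝ) (x y : BaseModel m) :
    BaseModel m →L[ℝ] ℝ :=
  fderiv ℝ (fun b => fderiv ℝ (fun w => f b w ^ 2) y) x y - fderiv ℝ (fun b => f b y ^ 2) x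

/-- `Gⁱ = ¼ gⁱʲ ([F²]_{yʲ xᵏ} yᵏ - [F²]_{xʲ})`. -/
def sprayCoeff (f : BaseModel m → BaseModel m → ℝ) (x y : BaseModel m) : BaseModel m :=
  (fundamentalTensor f x y).inverse ((1 / 4 : ℝ) • sprayCovector f x y)

/-- The value of `δyⁱ = F⁻¹ (dyⁱ + ∂Gⁱ/∂yʲ dxʲ)` on the tangent vector `ξ = (dx, dy)` at
`(x, y)`. -/
def deltaY (f : BaseModel m → BaseModel m → ℝ) (x y : BaseModel m)
    (ξ : BaseModel m × BaseModel m) : BaseModel m :=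
  (f x y)⁻¹ • (ξ.2 + fderiv ℝ (fun w => sprayCoeff f x w) y ξ.1)

/-- The Sasaki tensor `∑_{i ≤ n} ωⁱ ⊗ ωⁱ + ∑_{α < n} ω^{n+α} ⊗ ω^{n+α}` at `(x, y)` in local
coordinates of `TM \ 0`. Here `ωⁱ = vⁱ_j dxʲ` is a `g`-orthonormal coframe with
`ωⁿ = F_{yʲ} dxʲ`, and `ω^{n+α} = - v^α_j δyʲ`, so that `∑_{i ≤ n} vⁱ_j vⁱ_k = g_jk` and
`∑_{α < n} v^α_j v^α_k = g_jk - F_{yʲ} F_{yᵏ}`. -/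
def sasakiLocal (f : BaseModel m → BaseModel m → ℝ) (x y : BaseModel m)
    (ξ η : BaseModel m × BaseModel m) : ℝ :=
  fundamentalTensor f x y ξ.1 η.1 +
    (fundamentalTensor f x y (deltaY f x y ξ) (deltaY f x y η) -
      fderiv ℝ (fun w => f x w) y (deltaY f x y ξ) * fderiv ℝ (fun w => f x w) y (deltaY f x y η))

variable (m) (M : Type*) [TopologicalSpace M] [ChartedSpace (BaseModel m) M]
  [IsManifold (𝓡 (m + 1)) ∞ M]

/-- A Finsler structure on `M`: a positive smooth function on `TM \ 0` (its values on the zero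
section are irrelevant), positively homogeneous of degree one and with positive definite
fundamental tensor in all the natural coordinates. -/
structure FinslerStructure where
  /-- The Finsler function. -/
  toFun : TangentBundle (𝓡 (m + 1)) M → ℝ
  smooth : ContMDiffOn (𝓡 (m + 1)).tangent 𝓘(ℝ, ℝ) ∞ toFun {v | v.2 ≠ 0}
  pos : ∀ v : TangentBundle (𝓡 (m + 1)) M, v.2 ≠ 0 → 0 < toFun v
  homogeneous : ∀ (v : TangentBundle (𝓡 (m + 1)) M) (c : ℝ), v.2 ≠ 0 → 0 < c →
    toFun ⟨v.proj, c • v.2⟩ = c * toFun v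
  posDef : ∀ (x₀ : M) (x y u : BaseModel m), x ∈ (chartAt (BaseModel m) x₀).target →
    y ≠ 0 → u ≠ 0 →
    0 < fundamentalTensor (fun a w => toFun ((tangentCoord x₀).symm (a, w))) x y u u

variable {m M}

namespace FinslerStructure

variable (F : FinslerStructure m M)

/-- The Finsler function in the natural coordinates `(x, y)` around `x₀`. -/
def inCoord (x₀ : M) (x y : BaseModel m) : ℝ := F.toFun ((tangentCoord x₀).symm (x, y))

/-- The section `[y] ↦ y / F(y)` of `TM \ 0 → SM`, in the natural coordinates around `x₀`. -/
def unitLift (x₀ : M) : SphereBundle m M → BaseModel m × BaseModel m :=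
  Quotient.lift (fun v : SlitTangent m M =>
    ((tangentCoord x₀ v.1).1, (F.toFun v.1)⁻¹ • (tangentCoord x₀ v.1).2)) (by
    rintro ⟨⟨x, u⟩, hu⟩ ⟨w, hw⟩ ⟨c, hc, rfl⟩
    have h := F.homogeneous ⟨x, u⟩ c hu hc
    simp only at h
    simp only [tangentCoord_smul, h, smul_smul, mul_inv_rev]
    rw [mul_assoc, inv_mul_cancel₀ hc.ne', mul_one])

/-- The Sasaki-type Riemannian metric `g^{T(SM)}`: the pull-back of the Sasaki tensor of
`TM \ 0` under the section `[y] ↦ y / F(y)`. That tensor is invariant under scaling, vanishes on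
the radial direction and does not depend on the coordinates of `M`, so this is the tensor it
induces on `SM`; at `p` it is computed in the coordinates of `M` around `π(p)`. -/
def sasaki (p : SphereBundle m M) :
    LinearMap.BilinForm ℝ (TangentSpace 𝓘(ℝ, SphereModel m) p) :=
  let x₀ : M := p.proj
  let ℓ := F.unitLift x₀ p
  let dℓ : TangentSpace 𝓘(ℝ, SphereModel m) p →L[ℝ] BaseModel m × BaseModel m :=
    mvfderiv 𝓘(ℝ, SphereModel m) (F.unitLift x₀) p
  LinearMap.mk₂ ℝ (fun X Y => sasakiLocal (F.inCoord x₀) ℓ.1 ℓ.2 (dℓ X) (dℓ Y))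
    (fun X X' Y => by simp only [sasakiLocal, deltaY, map_add, smul_add, Prod.fst_add, Prod.snd_add, map_smul, add_apply, smul_apply, smul_eq_mul]; ring)
    (fun c X Y => by simp only [sasakiLocal, deltaY, map_add, smul_add, map_smul, Prod.smul_fst, Prod.smul_snd, add_apply, smul_apply, smul_eq_mul]; ring)
    (fun X Y Y' => by simp only [sasakiLocal, deltaY, map_add, smul_add, Prod.fst_add, Prod.snd_add, map_smul, add_apply, smul_apply, smul_eq_mul]; ring)
    (fun c X Y => by simp only [sasakiLocal, deltaY, map_add, smul_add, map_smul, Prod.smul_fst, Prod.smul_snd, add_apply, smul_apply, smul_eq_mul]; ring)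

end FinslerStructure

end Finsler

section Foliation

variable {E : Type*} [NormedAddCommGroup E] [NormedSpace ℝ E]
  {N : Type*} [TopologicalSpace N] [ChartedSpace E N]

/-- The conformal metric `e^{2f} g`. -/
def conformal (g : ∀ p : N, LinearMap.BilinForm ℝ (TangentSpace 𝓘(ℝ, E) p)) (f : N → ℝ) (p : N) :
    LinearMap.BilinForm ℝ (TangentSpace 𝓘(ℝ, E) p) :=
  Real.exp (2 * f p) • g p

/-- The `g`-orthogonal complement `V^⊥` of a subbundle `V` of `TN`. -/
def perp (g : ∀ p : N, LinearMap.BilinForm ℝ (TangentSpace 𝓘(ℝ, E) p))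
    (V : ∀ p : N, Submodule ℝ (TangentSpace 𝓘(ℝ, E) p)) (p : N) :
    Submodule ℝ (TangentSpace 𝓘(ℝ, E) p) :=
  (g p).orthogonal (V p)

open Classical in
/-- The orthogonal projection `p^⊥ : TN → V^⊥`, along `V`. -/
def projPerp (g : ∀ p : N, LinearMap.BilinForm ℝ (TangentSpace 𝓘(ℝ, E) p))
    (V : ∀ p : N, Submodule ℝ (TangentSpace 𝓘(ℝ, E) p)) (p : N) :
    TangentSpace 𝓘(ℝ, E) p →ₗ[ℝ] TangentSpace 𝓘(ℝ, E) p :=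
  if h : IsCompl (perp g V p) (V p) then Submodule.projection (perp g V p) (V p) h else 0

variable [IsManifold 𝓘(ℝ, E) ∞ N]

/-- The operator `(X, U) ↦ D_X U` of the Bott connection on `V^⊥` with respect to
`g`, where `nabla` is the Levi-Civita connection of `g`: on the component of `X` in `V` it is
`p^⊥ [X, U]`, on the component of `X` in `V^⊥` it is `p^⊥ ∇_X U`. -/
def bott (g : ∀ p : N, LinearMap.BilinForm ℝ (TangentSpace 𝓘(ℝ, E) p))
    (V : ∀ p : N, Submodule ℝ (TangentSpace 𝓘(ℝ, E) p))
    (nabla : CovariantDerivative 𝓘(ℝ, E) E (TangentSpace 𝓘(ℝ, E) : N → Type _))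
    (X U : ∀ p : N, TangentSpace 𝓘(ℝ, E) p) (p : N) : TangentSpace 𝓘(ℝ, E) p :=
  projPerp g V p
      (VectorField.mlieBracket 𝓘(ℝ, E) (fun q => X q - projPerp g V q (X q)) U p) +
    projPerp g V p (nabla U p (projPerp g V p (X p)))

/-- `Dstar` is the dual, with respect to `g`, of the connection `D` on `V^⊥`: it takes values in
`V^⊥` and `X⟨U, W⟩ = ⟨D_X U, W⟩ + ⟨U, D*_X W⟩` for all vector fields `X` and all sections `U`, `W`
of `V^⊥`. -/
def IsDualConnection (g : ∀ p : N, LinearMap.BilinForm ℝ (TangentSpace 𝓘(ℝ, E) p))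
    (V : ∀ p : N, Submodule ℝ (TangentSpace 𝓘(ℝ, E) p))
    (D Dstar : (∀ p : N, TangentSpace 𝓘(ℝ, E) p) → (∀ p : N, TangentSpace 𝓘(ℝ, E) p) →
      ∀ p : N, TangentSpace 𝓘(ℝ, E) p) : Prop :=
  ∀ (p : N) (X U W : ∀ q : N, TangentSpace 𝓘(ℝ, E) q),
    MDiffAt (T% X) p → MDiffAt (T% U) p → MDiffAt (T% W) p →
    (∀ q, U q ∈ perp g V q) → (∀ q, W q ∈ perp g V q) →
    Dstar X W p ∈ perp g V p ∧
    mvfderiv 𝓘(ℝ, E) (fun q => g q (U q) (W q)) p (X p) =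
      g p (D X U p) (W p) + g p (U p) (Dstar X W p)

variable [FiniteDimensional ℝ E]

/-- `nabla` is the Levi-Civita connection of `g`: torsion free and metric. -/
def IsLeviCivita (g : ∀ p : N, LinearMap.BilinForm ℝ (TangentSpace 𝓘(ℝ, E) p))
    (nabla : CovariantDerivative 𝓘(ℝ, E) E (TangentSpace 𝓘(ℝ, E) : N → Type _)) : Prop :=
  haveI : CompleteSpace E := FiniteDimensional.complete ℝ E
  nabla.torsion = 0 ∧
  ∀ (p : N) (Y Z : ∀ q : N, TangentSpace 𝓘(ℝ, E) q) (X : TangentSpace 𝓘(ℝ, E) p),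
    MDiffAt (T% Y) p → MDiffAt (T% Z) p →
    mvfderiv 𝓘(ℝ, E) (fun q => g q (Y q) (Z q)) p X =
      g p (nabla Y p X) (Z p) + g p (Y p) (nabla Z p X)

/-- `H` is the endomorphism of `V^⊥`, with values in the one-forms on `N`, that is determined by
`2H = D* - D`, where `D` is the Bott connection on `V^⊥` with respect to `g` and `D*` is its dual;
`H p X U` is the value at `p` of the endomorphism `H(X)` on `U`. An endomorphism of `V^⊥` is
regarded as an endomorphism of `TN = V^⊥ ⊕ V` that vanishes on `V`. -/
def IsCartanEndomorphism (g : ∀ p : N, LinearMap.BilinForm ℝ (TangentSpace 𝓘(ℝ, E) p))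
    (V : ∀ p : N, Submodule ℝ (TangentSpace 𝓘(ℝ, E) p))
    (H : ∀ p : N, TangentSpace 𝓘(ℝ, E) p →ₗ[ℝ]
      TangentSpace 𝓘(ℝ, E) p →ₗ[ℝ] TangentSpace 𝓘(ℝ, E) p) : Prop :=
  (∀ (p : N) (X U : TangentSpace 𝓘(ℝ, E) p), U ∈ V p → H p X U = 0) ∧
  ∃ nabla : CovariantDerivative 𝓘(ℝ, E) E (TangentSpace 𝓘(ℝ, E) : N → Type _),
    IsLeviCivita g nabla ∧
    ∃ Dstar, IsDualConnection g V (bott g V nabla) Dstar ∧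
    ∀ (p : N) (X U : ∀ q : N, TangentSpace 𝓘(ℝ, E) q),
      MDiffAt (T% X) p → MDiffAt (T% U) p → (∀ q, U q ∈ perp g V q) →
      (2 : ℝ) • H p (X p) (U p) = Dstar X U p - bott g V nabla X U p

end Foliation

end

/-! The proof rests on a formula for the Cartan endomorphism in which the connection no longer
appears. For sections `U`, `W` of the normal bundle, write `X'` for the vertical part of `X`.
Duality gives 2⟨H(X)U, W⟩ = X⟨U, W⟩ - ⟨D_X U, W⟩ - ⟨U, D_X W⟩. In the normal part of `X` the Bott
connection is the projected Levi-Civita connection, so metricity cancels that contribution. What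
remains is X'⟨U, W⟩ - ⟨[X', U], W⟩ - ⟨U, [X', W]⟩, the Lie derivative of the transverse metric along
the leaves (`IsCartanEndomorphism.two_mul_inner`).

A conformal factor changes neither orthogonal complements nor orthogonal projections, and Lie
brackets do not involve the metric. If the factor is constant along the leaves, it also passes
through the derivative along `X'`. Hence both sides of the formula are multiplied by the same
factor, which cancels, and definiteness gives equality of the endomorphisms
(`IsCartanEndomorphism.conformal_eq`).

Applying this to the sphere bundle needs three facts. Positivity: the lift `[y] ↦ y / F(y)` is an
immersion into F = 1, and tangency to F = 1 excludes the radial direction, where the angular metric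
degenerates (`IsLocalFinsler.sasakiLocal_pos`). Differentiability: `sasaki` is computed at each
point in coordinates centred below that point, so it must first be rewritten in one fixed chart.
This uses the transformation laws of the spray and of `deltaY`
(`IsFinslerCoordChange.sasakiLocal_eq`, `FinslerStructure.sasaki_eq`). Normal sections through a
given vector: these come from projecting a differentiable field along a vertical frame, with
coefficients given by Cramer's rule (`IsDefiniteMetric.exists_section_perp`). -/

/-! ### Cartan endomorphisms and leafwise constant conformal factors -/

section CartanConformal

variable {E : Type*} [NormedAddCommGroup E] [NormedSpace ℝ E]
  {N : Type*} [TopologicalSpace N] [ChartedSpace E N]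
  {g : ∀ p : N, LinearMap.BilinForm ℝ (TangentSpace 𝓘(ℝ, E) p)}
  {V : ∀ p : N, Submodule ℝ (TangentSpace 𝓘(ℝ, E) p)}

/-- A field of symmetric positive definite bilinear forms on the tangent spaces. -/
structure IsDefiniteMetric (g : ∀ p : N, LinearMap.BilinForm ℝ (TangentSpace 𝓘(ℝ, E) p)) :
    Prop where
  symm : ∀ p u v, g p u v = g p v u
  pos : ∀ p u, u ≠ 0 → 0 < g p u u

theorem IsDefiniteMetric.conformal (hg : IsDefiniteMetric g) (f : N → ℝ) :
    IsDefiniteMetric (conformal g f) where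
  symm p u v := by simp [_root_.conformal, hg.symm p u v]
  pos p u hu := by
    have := hg.pos p u hu
    simp only [_root_.conformal, LinearMap.smul_apply, smul_eq_mul]
    positivity

theorem mem_perp_iff {p : N} {u : TangentSpace 𝓘(ℝ, E) p} :
    u ∈ perp g V p ↔ ∀ v ∈ V p, g p v u = 0 := Iff.rfl

/-- Orthogonality is insensitive to a nonzero factor. As a consequence the splitting of a vector
field into vertical and normal parts is the same for both metrics. -/
theorem perp_conformal (g : ∀ p : N, LinearMap.BilinForm ℝ (TangentSpace 𝓘(ℝ, E) p))
    (V : ∀ p : N, Submodule ℝ (TangentSpace 𝓘(ℝ, E) p)) (f : N → ℝ) :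
    perp (conformal g f) V = perp g V := by
  ext p u
  simp [mem_perp_iff, conformal]

theorem projPerp_conformal (g : ∀ p : N, LinearMap.BilinForm ℝ (TangentSpace 𝓘(ℝ, E) p))
    (V : ∀ p : N, Submodule ℝ (TangentSpace 𝓘(ℝ, E) p)) (f : N → ℝ) :
    projPerp (conformal g f) V = projPerp g V := by
  funext p
  unfold projPerp
  rw [perp_conformal]

/-- In the Leibniz rule the derivative of the exponential factor is a multiple of df(v) = 0. This is
where constancy along the leaves enters. -/
theorem mvfderiv_exp_mul {f φ : N → ℝ} {p : N} (hf : MDiffAt f p)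
    {v : TangentSpace 𝓘(ℝ, E) p} (hv : mvfderiv 𝓘(ℝ, E) f p v = 0) (hφ : MDiffAt φ p) :
    mvfderiv 𝓘(ℝ, E) (fun q => Real.exp (2 * f q) * φ q) p v =
      Real.exp (2 * f p) * mvfderiv 𝓘(ℝ, E) φ p v := by
  have he : MDiffAt (fun t : ℝ => Real.exp (2 * t)) (f p) :=
    (by fun_prop : DifferentiableAt ℝ (fun t : ℝ => Real.exp (2 * t)) (f p)).mdifferentiableAt
  have h1 : MDiffAt (fun q => Real.exp (2 * f q)) p := he.comp p hf
  have h2 : mvfderiv 𝓘(ℝ, E) (fun q => Real.exp (2 * f q)) p v = 0 := by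
    have h3 := mvfderiv_comp_apply (I := 𝓘(ℝ, ℝ)) (I' := 𝓘(ℝ, E))
      (g := fun t : ℝ => Real.exp (2 * t)) p he hf v
    have h4 : mfderiv 𝓘(ℝ, E) 𝓘(ℝ, ℝ) f p v = 0 := hv
    rw [h4, map_zero] at h3
    exact h3
  have h5 := congrArg (fun A => A v) (mvfderiv_mul h1 hφ)
  rw [Pi.mul_def] at h5
  simpa [h2] using h5

theorem mdifferentiableAt_pi {κ : Type*} [Fintype κ] {a : κ → N → ℝ} {p : N}
    (ha : ∀ k, MDiffAt (a k) p) : MDifferentiableAt 𝓘(ℝ, E) 𝓘(ℝ, κ → ℝ) (fun q k => a k q) p := by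
  simp only [mdifferentiableAt_iff] at ha ⊢
  exact ⟨continuousAt_pi.2 fun k => (ha k).1, differentiableWithinAt_pi.2 fun k => (ha k).2⟩

theorem mdifferentiableAt_det {ι : Type*} [Fintype ι] [DecidableEq ι] {A : N → Matrix ι ι ℝ}
    {p : N} (hA : ∀ i j, MDiffAt (fun q => A q i j) p) : MDiffAt (fun q => (A q).det) p := by
  have h1 := mdifferentiableAt_pi (a := fun (k : ι × ι) q => A q k.1 k.2) fun k => hA k.1 k.2
  have h2 : DifferentiableAt ℝ (fun a : ι × ι → ℝ => (Matrix.of fun i j => a (i, j)).det)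
      (fun k => A p k.1 k.2) := by
    simp only [Matrix.det_apply', Matrix.of_apply]
    fun_prop
  exact MDifferentiableAt.comp (I' := 𝓘(ℝ, ι × ι → ℝ)) (f := fun q (k : ι × ι) => A q k.1 k.2)
    (g := fun a : ι × ι → ℝ => (Matrix.of fun i j => a (i, j)).det) p h2.mdifferentiableAt h1

variable [FiniteDimensional ℝ E]

theorem IsDefiniteMetric.isCompl_perp (hg : IsDefiniteMetric g) (p : N) :
    IsCompl (perp g V p) (V p) := by
  have : FiniteDimensional ℝ (TangentSpace 𝓘(ℝ, E) p) := inferInstanceAs (FiniteDimensional ℝ E)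
  refine IsCompl.symm ((LinearMap.BilinForm.isCompl_orthogonal_iff_disjoint
    (fun u v h => by rw [hg.symm]; exact h)).2 ?_)
  rw [Submodule.disjoint_def]
  intro u hu hu'
  by_contra h0
  exact (hg.pos p u h0).ne' (hu' u hu)

theorem IsDefiniteMetric.projPerp_eq (hg : IsDefiniteMetric g) (p : N) :
    projPerp g V p = Submodule.projection (perp g V p) (V p) (hg.isCompl_perp p) :=
  dif_pos _

theorem IsDefiniteMetric.projPerp_mem (hg : IsDefiniteMetric g) (p : N)
    (u : TangentSpace 𝓘(ℝ, E) p) : projPerp g V p u ∈ perp g V p := by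
  rw [hg.projPerp_eq]
  simp

theorem IsDefiniteMetric.sub_projPerp_mem (hg : IsDefiniteMetric g) (p : N)
    (u : TangentSpace 𝓘(ℝ, E) p) : u - projPerp g V p u ∈ V p := by
  rw [hg.projPerp_eq]
  exact Submodule.sub_projection_mem _ _

/-- Uniqueness of the decomposition along complementary subspaces. It serves to recognise an
explicit formula as the orthogonal projection. -/
theorem IsDefiniteMetric.projPerp_of_sub_mem (hg : IsDefiniteMetric g) {p : N}
    {u w : TangentSpace 𝓘(ℝ, E) p} (hw : w ∈ perp g V p) (h : u - w ∈ V p) :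
    projPerp g V p u = w := by
  have h1 := hg.sub_projPerp_mem (V := V) p u
  have h2 : projPerp g V p u - w ∈ perp g V p := sub_mem (hg.projPerp_mem p u) hw
  have h3 : projPerp g V p u - w ∈ V p := by
    have := sub_mem h h1
    rwa [sub_sub_sub_cancel_left] at this
  exact sub_eq_zero.1 ((Submodule.disjoint_def.1 (hg.isCompl_perp p).disjoint) _ h2 h3)

theorem IsDefiniteMetric.inner_projPerp (hg : IsDefiniteMetric g) {p : N}
    (u : TangentSpace 𝓘(ℝ, E) p) {w : TangentSpace 𝓘(ℝ, E) p} (hw : w ∈ perp g V p) :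
    g p (projPerp g V p u) w = g p u w := by
  have := hw _ (hg.sub_projPerp_mem (V := V) p u)
  rw [map_sub, LinearMap.sub_apply, sub_eq_zero] at this
  exact this.symm

variable [IsManifold 𝓘(ℝ, E) ∞ N]

open VectorField

/-- The Cartan endomorphism measures the Lie derivative, along the leaves, of the metric induced on
the normal bundle. -/
theorem IsCartanEndomorphism.two_mul_inner (hg : IsDefiniteMetric g)
    {H : ∀ p : N, TangentSpace 𝓘(ℝ, E) p →ₗ[ℝ]
      TangentSpace 𝓘(ℝ, E) p →ₗ[ℝ] TangentSpace 𝓘(ℝ, E) p}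
    (hH : IsCartanEndomorphism g V H) {p : N} {X U W : ∀ q : N, TangentSpace 𝓘(ℝ, E) q}
    (hX : MDiffAt (T% X) p) (hU : MDiffAt (T% U) p) (hW : MDiffAt (T% W) p)
    (hUV : ∀ q, U q ∈ perp g V q) (hWV : ∀ q, W q ∈ perp g V q) :
    2 * g p (H p (X p) (U p)) (W p) =
      mvfderiv 𝓘(ℝ, E) (fun q => g q (U q) (W q)) p (X p - projPerp g V p (X p)) -
      g p (mlieBracket 𝓘(ℝ, E) (fun q => X q - projPerp g V q (X q)) U p) (W p) -
      g p (U p) (mlieBracket 𝓘(ℝ, E) (fun q => X q - projPerp g V q (X q)) W p) := by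
  obtain ⟨-, nabla, ⟨-, hmetric⟩, Dstar, hD, hHD⟩ := hH
  have h1 : 2 * g p (H p (X p) (U p)) (W p) =
      g p (Dstar X U p) (W p) - g p (bott g V nabla X U p) (W p) := by
    have := congrArg (fun z => g p z (W p)) (hHD p X U hX hU hUV)
    simpa using this
  -- Duality is used with the two sections exchanged, so that `Dstar` acts on `U`, as it does in the
  -- definition of `H`.
  have h2 := (hD p X W U hX hW hU hWV hUV).2
  have h3 := hmetric p U W (projPerp g V p (X p)) hU hW
  have h4 : ∀ Z : ∀ q : N, TangentSpace 𝓘(ℝ, E) q, Z p ∈ perp g V p →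
      ∀ Y : ∀ q : N, TangentSpace 𝓘(ℝ, E) q, g p (bott g V nabla X Y p) (Z p) =
      g p (mlieBracket 𝓘(ℝ, E) (fun q => X q - projPerp g V q (X q)) Y p) (Z p) +
      g p (nabla Y p (projPerp g V p (X p))) (Z p) := by
    intro Z hZ Y
    rw [bott, map_add, LinearMap.add_apply, hg.inner_projPerp _ hZ, hg.inner_projPerp _ hZ]
  have h5 : (fun q => g q (W q) (U q)) = fun q => g q (U q) (W q) :=
    funext fun q => hg.symm q _ _
  rw [h5, h4 U (hUV p) W, hg.symm p (W p)] at h2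
  -- The two `nabla` terms are those of `h3`, the derivative of the product along the normal part of
  -- `X`; they cancel, leaving only the vertical direction.
  rw [h1, h4 W (hWV p) U, map_sub, h2, h3, hg.symm p (U p), hg.symm p (U p)]
  ring

/-- Both connections take values in the normal bundle. Therefore the pairings with normal vectors,
which is all that `two_mul_inner` provides, determine `H` there. -/
theorem IsCartanEndomorphism.apply_mem_perp (hg : IsDefiniteMetric g)
    {H : ∀ p : N, TangentSpace 𝓘(ℝ, E) p →ₗ[ℝ]
      TangentSpace 𝓘(ℝ, E) p →ₗ[ℝ] TangentSpace 𝓘(ℝ, E) p}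
    (hH : IsCartanEndomorphism g V H) {p : N} {X U : ∀ q : N, TangentSpace 𝓘(ℝ, E) q}
    (hX : MDiffAt (T% X) p) (hU : MDiffAt (T% U) p) (hUV : ∀ q, U q ∈ perp g V q) :
    H p (X p) (U p) ∈ perp g V p := by
  obtain ⟨-, nabla, -, Dstar, hD, hHD⟩ := hH
  have h1 : (2 : ℝ) • H p (X p) (U p) ∈ perp g V p := by
    rw [hHD p X U hX hU hUV]
    exact sub_mem (hD p X U U hX hU hU hUV hUV).1
      (add_mem (hg.projPerp_mem _ _) (hg.projPerp_mem _ _))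
  exact (Submodule.smul_mem_iff _ two_ne_zero).1 h1

/-- The Cartan endomorphism of a foliation does not change under a conformal change of the metric
by a function that is constant along the leaves. -/
theorem IsCartanEndomorphism.conformal_eq (hg : IsDefiniteMetric g)
    (hgd : ∀ (p : N) (Y Z : ∀ q : N, TangentSpace 𝓘(ℝ, E) q),
      MDiffAt (T% Y) p → MDiffAt (T% Z) p → MDiffAt (fun q => g q (Y q) (Z q)) p)
    (hext : ∀ (p : N), ∀ w ∈ perp g V p, ∃ W : ∀ q : N, TangentSpace 𝓘(ℝ, E) q,
      MDiffAt (T% W) p ∧ W p = w ∧ ∀ q, W q ∈ perp g V q)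
    {f : N → ℝ} (hf : ∀ p, MDiffAt f p) (hfV : ∀ p, ∀ v ∈ V p, mvfderiv 𝓘(ℝ, E) f p v = 0)
    {H H' : ∀ p : N, TangentSpace 𝓘(ℝ, E) p →ₗ[ℝ]
      TangentSpace 𝓘(ℝ, E) p →ₗ[ℝ] TangentSpace 𝓘(ℝ, E) p}
    (hH : IsCartanEndomorphism g V H) (hH' : IsCartanEndomorphism (conformal g f) V H') :
    H' = H := by
  funext p
  ext x u
  have hfd : FiniteDimensional ℝ (TangentSpace 𝓘(ℝ, E) p) :=
    inferInstanceAs (FiniteDimensional ℝ E)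
  -- On `V` both endomorphisms vanish by convention, so only normal vectors matter.
  suffices h : ∀ u ∈ perp g V p, H' p x u = H p x u by
    have h1 : u = projPerp g V p u + (u - projPerp g V p u) := by abel
    have h2 := hg.sub_projPerp_mem (V := V) p u
    rw [h1, map_add, map_add, h _ (hg.projPerp_mem p u), hH.1 p x _ h2, hH'.1 p x _ h2]
  intro u hu
  obtain ⟨U, hU, rfl, hUV⟩ := hext p u hu
  obtain ⟨X, hX, rfl⟩ : ∃ X : ∀ q : N, TangentSpace 𝓘(ℝ, E) q, MDiffAt (T% X) p ∧ X p = x :=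
    ⟨FiberBundle.extend E x, FiberBundle.mdifferentiableAt_extend 𝓘(ℝ, E) E x, by simp⟩
  have hUV' := hUV
  rw [← perp_conformal g V f] at hUV'
  have hmem : H' p (X p) (U p) - H p (X p) (U p) ∈ perp g V p := by
    have h1 := hH'.apply_mem_perp (hg.conformal f) hX hU hUV'
    rw [perp_conformal] at h1
    exact sub_mem h1 (hH.apply_mem_perp hg hX hU hUV)
  have hort : ∀ w ∈ perp g V p, g p (H' p (X p) (U p) - H p (X p) (U p)) w = 0 := by
    intro w hw
    obtain ⟨W, hW, rfl, hWV⟩ := hext p w hw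
    have hWV' := hWV
    rw [← perp_conformal g V f] at hWV'
    have h1 := hH.two_mul_inner hg hX hU hW hUV hWV
    have h2 := hH'.two_mul_inner (hg.conformal f) hX hU hW hUV' hWV'
    rw [projPerp_conformal] at h2
    simp only [conformal, LinearMap.smul_apply, smul_eq_mul] at h2
    -- The direction of differentiation is vertical, so the conformal factor comes out of this term
    -- as it already does out of the two bracket terms.
    rw [mvfderiv_exp_mul (hf p) (hfV p _ (hg.sub_projPerp_mem p _)) (hgd p U W hU hW)] at h2
    have h3 : Real.exp (2 * f p) * (2 * g p (H' p (X p) (U p)) (W p)) =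
        Real.exp (2 * f p) * (2 * g p (H p (X p) (U p)) (W p)) := by
      rw [h1]; linear_combination h2
    have h4 := mul_left_cancel₀ (Real.exp_pos _).ne' h3
    rw [map_sub, LinearMap.sub_apply]
    linarith
  by_contra h0
  exact (hg.pos p _ (sub_ne_zero.2 h0)).ne' (hort _ hmem)

/-- The orthogonal complement of a subbundle with a differentiable local frame is spanned by
differentiable sections. -/
theorem IsDefiniteMetric.exists_section_perp (hg : IsDefiniteMetric g) {p : N}
    (hgd : ∀ (Y Z : ∀ q : N, TangentSpace 𝓘(ℝ, E) q),
      MDiffAt (T% Y) p → MDiffAt (T% Z) p → MDiffAt (fun q => g q (Y q) (Z q)) p)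
    {ι : Type*} [Fintype ι] [DecidableEq ι] (s : ι → ∀ q : N, TangentSpace 𝓘(ℝ, E) q)
    (hs : ∀ i, MDiffAt (T% (s i)) p)
    (hsV : ∀ᶠ q in 𝓝 p, LinearIndependent ℝ (fun i => s i q) ∧
      Submodule.span ℝ (Set.range fun i => s i q) = V q)
    {w : TangentSpace 𝓘(ℝ, E) p} (hw : w ∈ perp g V p) :
    ∃ W : ∀ q : N, TangentSpace 𝓘(ℝ, E) q,
      MDiffAt (T% W) p ∧ W p = w ∧ ∀ q, W q ∈ perp g V q := by
  obtain ⟨Y, hY, rfl⟩ : ∃ Y : ∀ q : N, TangentSpace 𝓘(ℝ, E) q, MDiffAt (T% Y) p ∧ Y p = w :=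
    ⟨FiberBundle.extend E w, FiberBundle.mdifferentiableAt_extend 𝓘(ℝ, E) E w, by simp⟩
  -- The pointwise projection is normal at every point by construction; the frame and the explicit
  -- formula are needed only near `p`, for differentiability.
  refine ⟨fun q => projPerp g V q (Y q), ?_,
    hg.projPerp_of_sub_mem hw (by simp), fun q => hg.projPerp_mem q _⟩
  -- The coefficients `c` of the `V`-component of `Y` solve the Gram system G c = b. Writing the
  -- solution by Cramer's rule makes it rational in metric coefficients, hence differentiable where
  -- the determinant is nonzero.
  let G : N → Matrix ι ι ℝ := fun q i j => g q (s i q) (s j q)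
  let b : N → ι → ℝ := fun q i => g q (s i q) (Y q)
  let c : ι → N → ℝ := fun i q => (G q).det⁻¹ * (G q).cramer (b q) i
  have hdet : ∀ᶠ q in 𝓝 p, (G q).det ≠ 0 := by
    -- A vector `a` in the kernel of the Gram matrix gives a combination of the frame of length
    -- zero, contradicting definiteness and independence.
    filter_upwards [hsV] with q hq h0
    obtain ⟨a, ha, hGa⟩ := Matrix.exists_mulVec_eq_zero_iff.2 h0
    have h1 : g q (∑ i, a i • s i q) (∑ i, a i • s i q) = 0 := by
      have : g q (∑ i, a i • s i q) (∑ i, a i • s i q) = ∑ i, a i * (G q).mulVec a i := by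
        simp [G, Matrix.mulVec, dotProduct, map_sum, LinearMap.sum_apply, Finset.mul_sum]
        rw [Finset.sum_comm]
        refine Finset.sum_congr rfl fun i _ => Finset.sum_congr rfl fun j _ => ?_
        ring
      rw [this, hGa]; simp
    have h2 : ∑ i, a i • s i q = 0 := by
      by_contra h; exact (hg.pos q _ h).ne' h1
    exact ha (funext fun i => Fintype.linearIndependent_iff.1 hq.1 a h2 i)
  have heq : ∀ᶠ q in 𝓝 p, projPerp g V q (Y q) = Y q - ∑ i, c i q • s i q := by
    filter_upwards [hsV, hdet] with q hq hq'
    refine hg.projPerp_of_sub_mem ?_ ?_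
    · have h1 : (G q).mulVec (fun i => c i q) = b q := by
        have : (fun i => c i q) = (G q).det⁻¹ • (G q).cramer (b q) := by
          funext i; simp [c]
        rw [this, Matrix.mulVec_smul, Matrix.mulVec_cramer, smul_smul, inv_mul_cancel₀ hq', one_smul]
      rw [mem_perp_iff, ← hq.2]
      intro v hv
      induction hv using Submodule.span_induction with
      | mem v hv =>
        obtain ⟨i, rfl⟩ := hv
        have h2 := congrFun h1 i
        simp only [Matrix.mulVec, dotProduct, G, b] at h2
        simp only [map_sub, map_sum, map_smul, smul_eq_mul, ← h2]
        rw [sub_eq_zero]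
        exact Finset.sum_congr rfl fun j _ => mul_comm _ _
      | zero => simp
      | add v v' _ _ h h' => rw [map_add, LinearMap.add_apply, h, h', add_zero]
      | smul a v _ h => rw [map_smul, LinearMap.smul_apply, h, smul_zero]
    · rw [sub_sub_cancel, ← hq.2]
      exact Submodule.sum_mem _ fun i _ =>
        Submodule.smul_mem _ _ (Submodule.subset_span ⟨i, rfl⟩)
  have hG : ∀ i j, MDiffAt (fun q => G q i j) p := fun i j => hgd _ _ (hs i) (hs j)
  have hc : ∀ i, MDiffAt (c i) p := by
    intro i
    have h1 : MDiffAt (fun q => (G q).cramer (b q) i) p := by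
      simp only [Matrix.cramer_apply]
      refine mdifferentiableAt_det fun k j => ?_
      simp only [Matrix.updateCol_apply]
      split_ifs
      · exact hgd _ _ (hs k) hY
      · exact hG k j
    have h2 : MDiffAt (fun t : ℝ => t⁻¹) (G p).det :=
      (differentiableAt_inv hdet.self_of_nhds).mdifferentiableAt
    exact (h2.comp p (mdifferentiableAt_det hG)).mul h1
  have hW : MDiffAt (T% (fun q => Y q - ∑ i, c i q • s i q)) p :=
    mdifferentiableAt_sub_section hY
      (MDifferentiableAt.sum_section fun i _ => (hc i).smul_section (hs i))
  refine hW.congr_of_eventuallyEq ?_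
  filter_upwards [heq] with q hq
  rw [hq]

end CartanConformal

/-! ### Charts of the sphere bundle and its vertical bundle -/

section SphereBundleCharts

variable {m : ℕ} {M : Type*} [TopologicalSpace M] [ChartedSpace (BaseModel m) M]
  [IsManifold (𝓡 (m + 1)) ∞ M]

namespace SphereBundle

theorem coordChart_mem_atlas (x₀ : M) (L : BaseModel m ≃L[ℝ] ℝ × EuclideanSpace ℝ (Fin m)) :
    coordChart x₀ L ∈ atlas (SphereModel m) (SphereBundle m M) := ⟨x₀, L, rfl⟩

theorem proj_mem_source {x₀ : M} {L : BaseModel m ≃L[ℝ] ℝ × EuclideanSpace ℝ (Fin m)}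
    {q : SphereBundle m M} (hq : q ∈ (coordChart x₀ L).source) :
    q.proj ∈ (chartAt (BaseModel m) x₀).source := by
  obtain ⟨v⟩ := q
  exact (mem_tangentCoord_source x₀ v.1).1 hq.1

/-- The identity holds outside the chart domain as well. Hence the two compositions can be equated
as functions before differentiating in `mem_vertical_iff`. -/
theorem coordChart_fst (x₀ : M) (L : BaseModel m ≃L[ℝ] ℝ × EuclideanSpace ℝ (Fin m))
    (q : SphereBundle m M) : (coordChart x₀ L q).1 = chartAt (BaseModel m) x₀ q.proj := by
  obtain ⟨v⟩ := q
  rfl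

theorem proj_eq_of_mem_source {x₀ : M} {L : BaseModel m ≃L[ℝ] ℝ × EuclideanSpace ℝ (Fin m)}
    {q : SphereBundle m M} (hq : q ∈ (coordChart x₀ L).source) :
    q.proj = (chartAt (BaseModel m) x₀).symm (coordChart x₀ L q).1 := by
  rw [coordChart_fst, (chartAt (BaseModel m) x₀).left_inv (proj_mem_source hq)]

theorem mdifferentiableAt_proj (q : SphereBundle m M) :
    MDifferentiableAt 𝓘(ℝ, SphereModel m) (𝓡 (m + 1)) (proj : SphereBundle m M → M) q := by
  obtain ⟨x₀, L, hq⟩ := exists_coordChart q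
  have h1 : MDifferentiableAt 𝓘(ℝ, SphereModel m) 𝓘(ℝ, SphereModel m) (coordChart x₀ L) q :=
    mdifferentiableAt_atlas (coordChart_mem_atlas x₀ L) hq
  have h2 : MDifferentiableAt 𝓘(ℝ, SphereModel m) (𝓡 (m + 1))
      (Prod.fst : SphereModel m → BaseModel m) (coordChart x₀ L q) :=
    differentiableAt_fst.mdifferentiableAt
  have h3 : MDifferentiableAt (𝓡 (m + 1)) (𝓡 (m + 1)) (chartAt (BaseModel m) x₀).symm
      (coordChart x₀ L q).1 := by
    refine mdifferentiableAt_atlas_symm (chart_mem_atlas _ x₀) ?_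
    rw [coordChart_fst]
    exact (chartAt (BaseModel m) x₀).map_source (proj_mem_source hq)
  refine ((h3.comp _ h2).comp q h1).congr_of_eventuallyEq ?_
  filter_upwards [(coordChart x₀ L).open_source.mem_nhds hq] with q' hq'
  exact proj_eq_of_mem_source hq'

/-- In a chart `coordChart x₀ L`, the vertical vectors are those without `dx` component. -/
theorem mem_vertical_iff {x₀ : M} {L : BaseModel m ≃L[ℝ] ℝ × EuclideanSpace ℝ (Fin m)}
    {q : SphereBundle m M} (hq : q ∈ (coordChart x₀ L).source)
    (v : TangentSpace 𝓘(ℝ, SphereModel m) q) :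
    v ∈ vertical q ↔
      (mvfderiv 𝓘(ℝ, SphereModel m) (coordChart x₀ L) q v).1 = 0 := by
  have hs := proj_mem_source hq
  have h1 : MDifferentiableAt 𝓘(ℝ, SphereModel m) 𝓘(ℝ, SphereModel m) (coordChart x₀ L) q :=
    mdifferentiableAt_atlas (coordChart_mem_atlas x₀ L) hq
  have hch := mdifferentiable_of_mem_atlas (I := 𝓡 (m + 1)) (chart_mem_atlas (BaseModel m) x₀)
  have h2 : (mvfderiv 𝓘(ℝ, SphereModel m) (coordChart x₀ L) q v).1 =
      mfderiv (𝓡 (m + 1)) (𝓡 (m + 1)) (chartAt (BaseModel m) x₀) q.proj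
        (mfderiv 𝓘(ℝ, SphereModel m) (𝓡 (m + 1)) (proj : SphereBundle m M → M) q v) := by
    have h3 := mfderiv_comp_apply q (hch.mdifferentiableAt hs) (mdifferentiableAt_proj q) v
    have h4 : MDifferentiableAt 𝓘(ℝ, SphereModel m) (𝓡 (m + 1))
        (Prod.fst : SphereModel m → BaseModel m) (coordChart x₀ L q) :=
      differentiableAt_fst.mdifferentiableAt
    have h5 := mfderiv_comp_apply q h4 h1 v
    have h6 : (chartAt (BaseModel m) x₀ ∘ proj : SphereBundle m M → BaseModel m) =
        Prod.fst ∘ coordChart x₀ L := funext fun q' => (coordChart_fst x₀ L q').symm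
    rw [h6] at h3
    rw [← h3, h5, mfderiv_eq_fderiv, fderiv_fst]
    rfl
  rw [h2]
  refine ⟨fun h => ?_, fun h => ?_⟩
  · have h' : mfderiv 𝓘(ℝ, SphereModel m) (𝓡 (m + 1)) (proj : SphereBundle m M → M) q v = 0 := h
    rw [h', map_zero]
    rfl
  · refine hch.mfderiv_injective hs ?_
    rw [map_zero]
    exact h

/-- The vertical bundle has differentiable local frames. -/
theorem exists_frame_vertical (p : SphereBundle m M) :
    ∃ s : Fin m → ∀ q : SphereBundle m M, TangentSpace 𝓘(ℝ, SphereModel m) q,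
      (∀ i, MDifferentiableAt 𝓘(ℝ, SphereModel m) 𝓘(ℝ, SphereModel m).tangent (fun q =>
        (⟨q, s i q⟩ : TangentBundle 𝓘(ℝ, SphereModel m) (SphereBundle m M))) p) ∧
      ∀ᶠ q in 𝓝 p, LinearIndependent ℝ (fun i => s i q) ∧
        Submodule.span ℝ (Set.range fun i => s i q) = vertical q := by
  let t := trivializationAt (SphereModel m)
    (TangentSpace 𝓘(ℝ, SphereModel m) : SphereBundle m M → Type _) p
  -- The frame consists of the coordinate fields in the fibre directions of the chart at `p`.
  let e : Fin m → SphereModel m := fun i => (0, EuclideanSpace.single i 1)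
  have hsrc : (chartAt (SphereModel m) p).source ∈ 𝓝 p := chart_source_mem_nhds _ p
  refine ⟨fun i q => t.symm q (e i), fun i => ?_, ?_⟩
  · rw [t.mdifferentiableAt_section_iff 𝓘(ℝ, SphereModel m) _
      (FiberBundle.mem_baseSet_trivializationAt' p)]
    have h1 : MDifferentiableAt 𝓘(ℝ, SphereModel m) 𝓘(ℝ, SphereModel m)
      (fun _ : SphereBundle m M => e i) p := mdifferentiableAt_const
    refine h1.congr_of_eventuallyEq ?_
    filter_upwards [hsrc] with q hq
    have hq' : q ∈ t.baseSet := by simpa [t] using hq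
    simp [t.apply_mk_symm hq']
  · filter_upwards [hsrc] with q hq
    have hq' : q ∈ t.baseSet := by simpa [t] using hq
    obtain ⟨x₀, L, hL⟩ : chartAt (SphereModel m) p ∈ atlas (SphereModel m) (SphereBundle m M) :=
      chart_mem_atlas _ p
    -- The trivialization at `p` is the derivative of the preferred chart at `p`, which is some
    -- `coordChart x₀ L`; the coordinate criterion for verticality thus applies at all nearby `q`.
    have hd : ∀ v : TangentSpace 𝓘(ℝ, SphereModel m) q,
        mvfderiv 𝓘(ℝ, SphereModel m) (coordChart x₀ L) q v = t.continuousLinearMapAt ℝ q v := by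
      intro v
      rw [TangentBundle.continuousLinearMapAt_trivializationAt hq, ← hL]
      rfl
    have hV : ∀ v : TangentSpace 𝓘(ℝ, SphereModel m) q,
        v ∈ vertical q ↔ (t.continuousLinearMapAt ℝ q v).1 = 0 := by
      intro v
      rw [mem_vertical_iff (x₀ := x₀) (L := L) (by rw [← hL]; exact hq), hd]
    have hsymm : ∀ w, t.continuousLinearMapAt ℝ q (t.symm q w) = w := fun w => by
      rw [← t.symmL_apply (R := ℝ) hq', t.continuousLinearMapAt_symmL hq']
    have hsum : ∀ a : Fin m → ℝ, t.continuousLinearMapAt ℝ q (∑ i, a i • t.symm q (e i)) =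
        (0, WithLp.toLp 2 a) := by
      intro a
      simp only [map_sum, map_smul, hsymm]
      refine Prod.ext (by simp [e, Prod.fst_sum]) ?_
      ext j
      simp [e, Prod.snd_sum, Pi.single_apply]
    refine ⟨Fintype.linearIndependent_iff.2 fun a ha i => ?_, le_antisymm ?_ ?_⟩
    · have h1 := hsum a
      rw [ha, map_zero] at h1
      have h2 := congrArg Prod.snd h1
      have h3 := congrArg (fun z : EuclideanSpace ℝ (Fin m) => z i) h2
      simpa using h3.symm
    · rw [Submodule.span_le]
      rintro _ ⟨i, rfl⟩
      rw [SetLike.mem_coe, hV]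
      rw [hsymm]
    · intro v hv
      have h1 := hsum (t.continuousLinearMapAt ℝ q v).2
      have h2 : t.continuousLinearMapAt ℝ q (∑ i, (t.continuousLinearMapAt ℝ q v).2 i •
          t.symm q (e i)) = t.continuousLinearMapAt ℝ q v :=
        h1.trans (Prod.ext ((hV v).1 hv).symm rfl)
      have h3 := congrArg (t.symmL ℝ q) h2
      rw [t.symmL_continuousLinearMapAt hq', t.symmL_continuousLinearMapAt hq'] at h3
      rw [← h3]
      exact Submodule.sum_mem _ fun i _ =>
        Submodule.smul_mem _ _ (Submodule.subset_span ⟨i, rfl⟩)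

/-- The definition of `sasaki` at `p` uses coordinates centred at `p.proj`, so the base point of the
chart has to be prescribed. -/
theorem exists_coordChart_proj (p : SphereBundle m M) :
    ∃ L : BaseModel m ≃L[ℝ] ℝ × EuclideanSpace ℝ (Fin m), p ∈ (coordChart p.proj L).source := by
  obtain ⟨v, hv⟩ := p
  have hs : v ∈ (tangentCoord v.proj).source := by
    rw [mem_tangentCoord_source]; exact mem_chart_source _ _
  have hy := (tangentCoord_snd_ne_zero v.proj hs).2 hv
  let L₀ : BaseModel m ≃L[ℝ] ℝ × EuclideanSpace ℝ (Fin m) :=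
    ContinuousLinearEquiv.ofFinrankEq (by simp [add_comm])
  -- `A` sends the direction `y` to `L₀.symm (1, 0)`, so the composite with `L₀` has first component
  -- 1 on `y`, which is positive.
  obtain ⟨A, hA⟩ := SeparatingDual.exists_continuousLinearEquiv_apply_eq (R := ℝ) hy
    (symm_one_ne_zero L₀ 0)
  refine ⟨A.trans L₀, hs, ?_⟩
  change 0 < ((A.trans L₀) (tangentCoord v.proj v).2).1
  simp [hA]

end SphereBundle

end SphereBundleCharts

/-! ### Euler identities and positivity in natural coordinates -/

section LocalFinsler

variable {m : ℕ}

/-- A Finsler function on `T ×ˢ (ℝ^(m+1) \ 0)`, in the coordinates `(x, y)`. -/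
structure IsLocalFinsler (f : BaseModel m → BaseModel m → ℝ) (T : Set (BaseModel m)) : Prop where
  isOpen : IsOpen T
  smooth : ContDiffOn ℝ ∞ (fun w : BaseModel m × BaseModel m => f w.1 w.2) (T ×ˢ {0}ᶜ)
  pos : ∀ x ∈ T, ∀ y ≠ 0, 0 < f x y
  homogeneous : ∀ x ∈ T, ∀ y ≠ 0, ∀ c : ℝ, 0 < c → f x (c • y) = c * f x y
  posDef : ∀ x ∈ T, ∀ y ≠ 0, ∀ u ≠ 0, 0 < fundamentalTensor f x y u u

namespace IsLocalFinsler

variable {f : BaseModel m → BaseModel m → ℝ} {T : Set (BaseModel m)} (hf : IsLocalFinsler f T)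
  {x y : BaseModel m}

include hf

theorem contDiffAt (hx : x ∈ T) (hy : y ≠ 0) :
    ContDiffAt ℝ ∞ (fun w : BaseModel m × BaseModel m => f w.1 w.2) (x, y) :=
  hf.smooth.contDiffAt ((hf.isOpen.prod isOpen_compl_singleton).mem_nhds ⟨hx, hy⟩)

theorem contDiffAt_fiber (hx : x ∈ T) (hy : y ≠ 0) : ContDiffAt ℝ ∞ (fun w => f x w) y :=
  (hf.contDiffAt hx hy).comp (f := fun w => (x, w)) y (by fun_prop)

theorem contDiffAt_sq (hx : x ∈ T) (hy : y ≠ 0) : ContDiffAt ℝ ∞ (fun w => f x w ^ 2) y :=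
  (hf.contDiffAt_fiber hx hy).pow 2

theorem differentiableAt_fderiv_sq (hx : x ∈ T) (hy : y ≠ 0) :
    DifferentiableAt ℝ (fun w => fderiv ℝ (fun w' => f x w' ^ 2) w) y :=
  ((hf.contDiffAt_sq hx hy).fderiv_right (m := 1) (by norm_cast)).differentiableAt one_ne_zero

theorem fundamentalTensor_symm (hx : x ∈ T) (hy : y ≠ 0) (u v : BaseModel m) :
    fundamentalTensor f x y u v = fundamentalTensor f x y v u := by
  have h := (hf.contDiffAt_sq hx hy).isSymmSndFDerivAt 
    (by rw [minSmoothness_of_isRCLikeNormedField]; exact WithTop.coe_le_coe.2 le_top)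
  simp only [fundamentalTensor, smul_apply]
  rw [h.eq u v]

/-- Euler's identity for `F`. -/
theorem fderiv_apply_self (hx : x ∈ T) (hy : y ≠ 0) : fderiv ℝ (fun w => f x w) y y = f x y := by
  have h1 : HasDerivAt (fun c : ℝ => f x (c • y)) (fderiv ℝ (fun w => f x w) y y) 1 := by
    have h2 : HasFDerivAt (fun w => f x w) (fderiv ℝ (fun w => f x w) y) ((1 : ℝ) • y) := by
      rw [one_smul]
      exact ((hf.contDiffAt_fiber hx hy).differentiableAt (by simp)).hasFDerivAt
    have h3 : HasDerivAt (fun c : ℝ => c • y) ((1 : ℝ) • y) 1 := (hasDerivAt_id 1).smul_const y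
    rw [one_smul] at h3
    exact h2.comp_hasDerivAt 1 h3
  have h4 : HasDerivAt (fun c : ℝ => f x (c • y)) (f x y) 1 := by
    have h5 : HasDerivAt (fun c : ℝ => c * f x y) (1 * f x y) 1 :=
      (hasDerivAt_id 1).mul_const (f x y)
    rw [one_mul] at h5
    refine h5.congr_of_eventuallyEq ?_
    filter_upwards [lt_mem_nhds (zero_lt_one' ℝ)] with c hc
    exact hf.homogeneous x hx y hy c hc
  exact h1.unique h4

theorem fderiv_sq (hx : x ∈ T) (hy : y ≠ 0) (u : BaseModel m) :
    fderiv ℝ (fun w => f x w ^ 2) y u = 2 * f x y * fderiv ℝ (fun w => f x w) y u := by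
  have h := ((hf.contDiffAt_fiber hx hy).differentiableAt (by simp)).hasFDerivAt.pow 2
  rw [h.fderiv]
  simp

/-- The derivative of `F²` along the fibres is positively homogeneous of degree one. -/
theorem fderiv_sq_smul (hx : x ∈ T) (hy : y ≠ 0) {c : ℝ} (hc : 0 < c) :
    fderiv ℝ (fun w => f x w ^ 2) (c • y) = c • fderiv ℝ (fun w => f x w ^ 2) y := by
  have hcy : c • y ≠ 0 := smul_ne_zero hc.ne' hy
  have h1 : HasFDerivAt (fun w => f x (c • w) ^ 2)
      ((fderiv ℝ (fun w => f x w ^ 2) (c • y)).comp (c • ContinuousLinearMap.id ℝ _)) y :=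
    (((hf.contDiffAt_sq hx hcy).differentiableAt (by simp)).hasFDerivAt).comp
      (f := fun w => c • w) y ((hasFDerivAt_id y).const_smul c)
  have h2 : HasFDerivAt (fun w => f x (c • w) ^ 2)
      ((c ^ 2) • fderiv ℝ (fun w => f x w ^ 2) y) y := by
    refine ((((hf.contDiffAt_sq hx hy).differentiableAt
      (by simp)).hasFDerivAt).const_smul (c ^ 2)).congr_of_eventuallyEq ?_
    filter_upwards [isOpen_compl_singleton.mem_nhds hy] with w hw
    simp [hf.homogeneous x hx w hw c hc, mul_pow]
  have h3 := h1.unique h2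
  ext u
  have h4 := congrArg (fun A => A u) h3
  simp only [ContinuousLinearMap.comp_apply, smul_apply, ContinuousLinearMap.id_apply, map_smul,
    smul_eq_mul] at h4 ⊢
  refine mul_left_cancel₀ hc.ne' ?_
  rw [h4]; ring

/-- Euler's identity for the fibre derivative of F², which is homogeneous of degree one:
differentiate D(cy) = c D(y) at c = 1. -/
theorem fundamentalTensor_self (hx : x ∈ T) (hy : y ≠ 0) (u : BaseModel m) :
    fundamentalTensor f x y y u = f x y * fderiv ℝ (fun w => f x w) y u := by
  set D := fun w => fderiv ℝ (fun w' => f x w' ^ 2) w with hD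
  have h1 : HasDerivAt (fun c : ℝ => D (c • y)) (fderiv ℝ D y y) 1 := by
    have h2 : HasFDerivAt D (fderiv ℝ D y) ((1 : ℝ) • y) := by
      rw [one_smul]
      exact (hf.differentiableAt_fderiv_sq hx hy).hasFDerivAt
    have h3 : HasDerivAt (fun c : ℝ => c • y) ((1 : ℝ) • y) 1 := (hasDerivAt_id 1).smul_const y
    rw [one_smul] at h3
    exact h2.comp_hasDerivAt 1 h3
  have h4 : HasDerivAt (fun c : ℝ => D (c • y)) (D y) 1 := by
    have h5 : HasDerivAt (fun c : ℝ => c • D y) ((1 : ℝ) • D y) 1 :=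
      (hasDerivAt_id 1).smul_const (D y)
    rw [one_smul] at h5
    refine h5.congr_of_eventuallyEq ?_
    filter_upwards [lt_mem_nhds (zero_lt_one' ℝ)] with c hc
    exact hf.fderiv_sq_smul hx hy hc
  have h6 := h1.unique h4
  simp only [fundamentalTensor, smul_apply, smul_eq_mul]
  rw [h6, hD, hf.fderiv_sq hx hy]
  ring

/-- The angular metric `g_ij - F_{yⁱ} F_{yʲ}` is `g_ij` applied to the components orthogonal to
`y`. -/
theorem angular_eq (hx : x ∈ T) (hy : y ≠ 0) (u : BaseModel m) :
    fundamentalTensor f x y u u - fderiv ℝ (fun w => f x w) y u * fderiv ℝ (fun w => f x w) y u =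
      fundamentalTensor f x y (u - (fderiv ℝ (fun w => f x w) y u / f x y) • y)
        (u - (fderiv ℝ (fun w => f x w) y u / f x y) • y) := by
  have h0 := (hf.pos x hx y hy).ne'
  simp only [map_sub, map_smul, sub_apply, smul_apply, smul_eq_mul,
    hf.fundamentalTensor_symm hx hy u y, hf.fundamentalTensor_self hx hy,
    hf.fderiv_apply_self hx hy]
  field_simp
  ring

theorem sasakiLocal_symm (hx : x ∈ T) (hy : y ≠ 0) (ξ η : BaseModel m × BaseModel m) :
    sasakiLocal f x y ξ η = sasakiLocal f x y η ξ := by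
  simp only [sasakiLocal]
  rw [hf.fundamentalTensor_symm hx hy ξ.1, hf.fundamentalTensor_symm hx hy (deltaY f x y ξ),
    mul_comm]

theorem fundamentalTensor_nonneg (hx : x ∈ T) (hy : y ≠ 0) (u : BaseModel m) :
    0 ≤ fundamentalTensor f x y u u := by
  rcases eq_or_ne u 0 with rfl | hu
  · simp
  · exact (hf.posDef x hx y hy u hu).le

/-- The Sasaki tensor is positive definite on the indicatrix bundle `F = 1`. -/
theorem sasakiLocal_pos (hx : x ∈ T) (hy : y ≠ 0) {ξ : BaseModel m × BaseModel m}
    (h1 : fderiv ℝ (fun w : BaseModel m × BaseModel m => f w.1 w.2) (x, y) ξ = 0) (hξ : ξ ≠ 0) :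
    0 < sasakiLocal f x y ξ ξ := by
  have h0 := (hf.pos x hx y hy).ne'
  rw [sasakiLocal, hf.angular_eq hx hy]
  have hn := hf.fundamentalTensor_nonneg hx hy
  -- Both summands are nonnegative. A nonzero `dx` part makes the first positive; otherwise `ξ` is
  -- vertical and the angular term must be.
  rcases ne_or_eq ξ.1 0 with h2 | h2
  · exact add_pos_of_pos_of_nonneg (hf.posDef x hx y hy _ h2) (hn _)
  · refine add_pos_of_nonneg_of_pos (hn _) (hf.posDef x hx y hy _ fun h3 => hξ ?_)
    -- For vertical `ξ`, tangency to the level set of F says that F_y annihilates `ξ.2`. The radial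
    -- correction in `angular_eq` then vanishes, and the angular term is g of `ξ.2 / F`.
    have h4 : fderiv ℝ (fun w => f x w) y ξ.2 = 0 := by
      have h5 := ((hf.contDiffAt hx hy).differentiableAt (by simp)).hasFDerivAt.comp
        (f := fun w => (x, w)) y ((hasFDerivAt_const x y).prodMk (hasFDerivAt_id y))
      have h6 : fderiv ℝ (fun w => f x w) y ξ.2 =
          fderiv ℝ (fun w : BaseModel m × BaseModel m => f w.1 w.2) (x, y) (0, ξ.2) := by
        rw [HasFDerivAt.fderiv (f := fun w => f x w) h5]
        simp
      rw [h6, ← h1]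
      congr 1
      exact Prod.ext h2.symm rfl
    have h7 : deltaY f x y ξ = (f x y)⁻¹ • ξ.2 := by simp [deltaY, h2]
    rw [h7, map_smul, h4, smul_zero, zero_div, zero_smul, sub_zero] at h3
    exact Prod.ext h2 ((smul_eq_zero.1 h3).resolve_left (inv_ne_zero h0))

end IsLocalFinsler

end LocalFinsler

/-! ### The unit lift and positivity of the Sasaki metric -/

section SasakiMetric

variable {m : ℕ} {M : Type*} [TopologicalSpace M] [ChartedSpace (BaseModel m) M]
  [IsManifold (𝓡 (m + 1)) ∞ M]

theorem extChartAt_tangentBundle_target (x₀ : M) :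
    (extChartAt (𝓡 (m + 1)).tangent (⟨x₀, 0⟩ : TangentBundle (𝓡 (m + 1)) M)).target =
        (tangentCoord x₀).target := by
  have h : ∀ w : BaseModel m × BaseModel m, w ∈ range (𝓡 (m + 1)).tangent := fun w => ⟨w, rfl⟩
  rw [extChartAt_target]
  ext w
  exact ⟨fun hw => hw.1, fun hw => ⟨hw, h w⟩⟩

theorem extChartAt_tangentBundle_symm (x₀ : M) (w : BaseModel m × BaseModel m) :
    (extChartAt (𝓡 (m + 1)).tangent (⟨x₀, 0⟩ : TangentBundle (𝓡 (m + 1)) M)).symm w =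
        (tangentCoord x₀).symm w := by
  rw [extChartAt_coe_symm]
  rfl

theorem mem_tangentCoord_target (x₀ : M) (w : BaseModel m × BaseModel m) :
    w ∈ (tangentCoord x₀).target ↔ w.1 ∈ (chartAt (BaseModel m) x₀).target :=
  TangentBundle.mem_chart_target_iff w ⟨x₀, 0⟩

theorem FinslerStructure.contDiffOn_inCoord (F : FinslerStructure m M) (x₀ : M) :
    ContDiffOn ℝ ∞ (fun w : BaseModel m × BaseModel m => F.inCoord x₀ w.1 w.2)
      ((chartAt (BaseModel m) x₀).target ×ˢ {0}ᶜ) := by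
  have : IsManifold (𝓡 (m + 1)) (∞ + 1) M :=
    inferInstanceAs (IsManifold (𝓡 (m + 1)) ∞ M)
  -- The zero vector over `x₀` is not in the slit bundle, but it only selects the chart; the
  -- criterion ranges over the charts at all points.
  have h := (contMDiffOn_iff.1 F.smooth).2 (⟨x₀, 0⟩ : TangentBundle (𝓡 (m + 1)) M) 0
  refine ContDiffOn.congr_mono h (fun w _ => ?_) fun w hw => ?_
  · rw [Function.comp_apply, Function.comp_apply, extChartAt_tangentBundle_symm, inCoord]
    rfl
  · have h1 : w ∈ (tangentCoord x₀).target := (mem_tangentCoord_target x₀ w).2 hw.1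
    refine ⟨by rw [extChartAt_tangentBundle_target]; exact h1, ?_, ?_⟩
    · change (extChartAt (𝓡 (m + 1)).tangent (⟨x₀, 0⟩ : TangentBundle (𝓡 (m + 1)) M)).symm w ∈
        {v | v.2 ≠ 0}
      rw [extChartAt_tangentBundle_symm]
      exact SphereBundle.coord_symm_ne_zero x₀ h1 hw.2
    · rw [mem_preimage, extChartAt_source, chartAt_self_eq]
      trivial

theorem tangentCoord_fst (x₀ : M) (v : TangentBundle (𝓡 (m + 1)) M) :
    (tangentCoord x₀ v).1 = chartAt (BaseModel m) x₀ v.proj := rfl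

theorem tangentCoord_symm_smul (x₀ : M) {x : BaseModel m}
    (hx : x ∈ (chartAt (BaseModel m) x₀).target) (y : BaseModel m) (c : ℝ) :
    (tangentCoord x₀).symm (x, c • y) =
      ⟨((tangentCoord x₀).symm (x, y)).proj, c • ((tangentCoord x₀).symm (x, y)).2⟩ := by
  have h1 : (x, y) ∈ (tangentCoord x₀).target := (mem_tangentCoord_target x₀ _).2 hx
  have h2 : (x, c • y) ∈ (tangentCoord x₀).target := (mem_tangentCoord_target x₀ _).2 hx
  have h3 := (tangentCoord x₀).map_target h1
  refine (tangentCoord x₀).injOn ((tangentCoord x₀).map_target h2) ?_ ?_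
  · rw [mem_tangentCoord_source] at h3 ⊢
    exact h3
  · rw [tangentCoord_smul, (tangentCoord x₀).right_inv h2]
    have h4 := (tangentCoord x₀).right_inv h1
    exact Prod.ext (congrArg Prod.fst h4).symm (congrArg (fun w => c • w.2) h4).symm

namespace FinslerStructure

variable (F : FinslerStructure m M)

theorem isLocalFinsler (x₀ : M) :
    IsLocalFinsler (F.inCoord x₀) (chartAt (BaseModel m) x₀).target where
  isOpen := (chartAt (BaseModel m) x₀).open_target
  smooth := F.contDiffOn_inCoord x₀
  pos x hx y hy := F.pos _ (SphereBundle.coord_symm_ne_zero x₀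
    ((mem_tangentCoord_target x₀ (x, y)).2 hx) hy)
  homogeneous x hx y hy c hc := by
    rw [inCoord, tangentCoord_symm_smul x₀ hx]
    exact F.homogeneous _ c (SphereBundle.coord_symm_ne_zero x₀
      ((mem_tangentCoord_target x₀ (x, y)).2 hx) hy) hc
  posDef x hx y hy u hu := F.posDef x₀ x y u hx hy hu

theorem inCoord_tangentCoord (x₀ : M) {v : TangentBundle (𝓡 (m + 1)) M}
    (hv : v ∈ (tangentCoord x₀).source) :
    F.inCoord x₀ (tangentCoord x₀ v).1 (tangentCoord x₀ v).2 = F.toFun v := by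
  rw [inCoord, Prod.mk.eta, (tangentCoord x₀).left_inv hv]

theorem unitLift_fst (x₀ : M) (q : SphereBundle m M) :
    (F.unitLift x₀ q).1 = chartAt (BaseModel m) x₀ q.proj := by
  obtain ⟨v⟩ := q
  rfl

theorem unitLift_snd_ne_zero (x₀ : M) {q : SphereBundle m M}
    (hq : q.proj ∈ (chartAt (BaseModel m) x₀).source) : (F.unitLift x₀ q).2 ≠ 0 := by
  obtain ⟨v⟩ := q
  have hv : v.1 ∈ (tangentCoord x₀).source := (mem_tangentCoord_source x₀ v.1).2 hq
  exact smul_ne_zero (inv_ne_zero (F.pos v.1 v.2).ne')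
    ((tangentCoord_snd_ne_zero x₀ hv).2 v.2)

theorem unitLift_fst_mem (x₀ : M) {q : SphereBundle m M}
    (hq : q.proj ∈ (chartAt (BaseModel m) x₀).source) :
    (F.unitLift x₀ q).1 ∈ (chartAt (BaseModel m) x₀).target := by
  rw [unitLift_fst]
  exact (chartAt (BaseModel m) x₀).map_source hq

theorem inCoord_unitLift (x₀ : M) {q : SphereBundle m M}
    (hq : q.proj ∈ (chartAt (BaseModel m) x₀).source) :
    F.inCoord x₀ (F.unitLift x₀ q).1 (F.unitLift x₀ q).2 = 1 := by
  have hmem := F.unitLift_fst_mem x₀ hq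
  rw [unitLift_fst] at hmem
  obtain ⟨v⟩ := q
  have hv : v.1 ∈ (tangentCoord x₀).source := (mem_tangentCoord_source x₀ v.1).2 hq
  have hp := F.pos v.1 v.2
  change F.inCoord x₀ (tangentCoord x₀ v.1).1 ((F.toFun v.1)⁻¹ • (tangentCoord x₀ v.1).2) = 1
  rw [(F.isLocalFinsler x₀).homogeneous (tangentCoord x₀ v.1).1 hmem _ ((tangentCoord_snd_ne_zero x₀ hv).2 v.2) _
    (inv_pos.2 hp), F.inCoord_tangentCoord x₀ hv, inv_mul_cancel₀ hp.ne']

/-- The lift `[y] ↦ y / F(y)` in the coordinates `(x, z)` of `SM`. -/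
noncomputable def unitLiftInCoord (x₀ : M) (L : BaseModel m ≃L[ℝ] ℝ × EuclideanSpace ℝ (Fin m))
    (w : SphereModel m) : BaseModel m × BaseModel m :=
  (w.1, (F.inCoord x₀ w.1 (L.symm (1, w.2)))⁻¹ • L.symm (1, w.2))

/-- The coordinates `(x, z)` select the representative `L.symm (1, z)`, which is a positive multiple
of `y`; by homogeneity y / F(y) does not see the multiple. -/
theorem unitLift_eq (x₀ : M) {L : BaseModel m ≃L[ℝ] ℝ × EuclideanSpace ℝ (Fin m)}
    {q : SphereBundle m M} (hq : q ∈ (SphereBundle.coordChart x₀ L).source) :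
    F.unitLift x₀ q = F.unitLiftInCoord x₀ L (SphereBundle.coordChart x₀ L q) := by
  obtain ⟨v⟩ := q
  obtain ⟨hv, ht⟩ : v.1 ∈ (tangentCoord x₀).source ∧ 0 < (L (tangentCoord x₀ v.1).2).1 := hq
  have hx : (tangentCoord x₀ v.1).1 ∈ (chartAt (BaseModel m) x₀).target :=
    (mem_tangentCoord_target x₀ _).1 ((tangentCoord x₀).map_source hv)
  set t := (L (tangentCoord x₀ v.1).2).1 with htdef
  have h1 : L.symm (1, t⁻¹ • (L (tangentCoord x₀ v.1).2).2) = t⁻¹ • (tangentCoord x₀ v.1).2 := by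
    apply L.injective
    rw [map_smul, L.apply_symm_apply]
    exact Prod.ext (inv_mul_cancel₀ ht.ne').symm rfl
  change ((tangentCoord x₀ v.1).1, (F.toFun v.1)⁻¹ • (tangentCoord x₀ v.1).2) =
    ((tangentCoord x₀ v.1).1, (F.inCoord x₀ (tangentCoord x₀ v.1).1
      (L.symm (1, t⁻¹ • (L (tangentCoord x₀ v.1).2).2)))⁻¹ •
      L.symm (1, t⁻¹ • (L (tangentCoord x₀ v.1).2).2))
  rw [h1, (F.isLocalFinsler x₀).homogeneous _ hx _ ((tangentCoord_snd_ne_zero x₀ hv).2 v.2) _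
    (inv_pos.2 ht), F.inCoord_tangentCoord x₀ hv, smul_smul]
  congr 2
  field_simp

theorem contDiffAt_unitLiftInCoord (x₀ : M)
    (L : BaseModel m ≃L[ℝ] ℝ × EuclideanSpace ℝ (Fin m)) {w : SphereModel m}
    (hw : w.1 ∈ (chartAt (BaseModel m) x₀).target) :
    ContDiffAt ℝ ∞ (F.unitLiftInCoord x₀ L) w := by
  have hne := SphereBundle.symm_one_ne_zero L w.2
  have h1 : ContDiffAt ℝ ∞ (fun w : SphereModel m => F.inCoord x₀ w.1 (L.symm (1, w.2))) w :=
    ((F.isLocalFinsler x₀).contDiffAt hw hne).comp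
      (f := fun w : SphereModel m => (w.1, L.symm (1, w.2))) w (by fun_prop)
  exact contDiffAt_fst.prodMk
    ((h1.inv ((F.isLocalFinsler x₀).pos _ hw _ hne).ne').smul (by fun_prop))

theorem mdifferentiableAt_unitLift (x₀ : M) {q : SphereBundle m M}
    {L : BaseModel m ≃L[ℝ] ℝ × EuclideanSpace ℝ (Fin m)}
    (hq : q ∈ (SphereBundle.coordChart x₀ L).source) :
    MDifferentiableAt 𝓘(ℝ, SphereModel m) 𝓘(ℝ, BaseModel m × BaseModel m) (F.unitLift x₀) q := by
  have h1 : MDifferentiableAt 𝓘(ℝ, SphereModel m) 𝓘(ℝ, SphereModel m)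
      (SphereBundle.coordChart x₀ L) q :=
    mdifferentiableAt_atlas (SphereBundle.coordChart_mem_atlas x₀ L) hq
  have h2 : (SphereBundle.coordChart x₀ L q).1 ∈ (chartAt (BaseModel m) x₀).target := by
    rw [SphereBundle.coordChart_fst]
    exact (chartAt (BaseModel m) x₀).map_source (SphereBundle.proj_mem_source hq)
  have h3 := ((F.contDiffAt_unitLiftInCoord x₀ L h2).differentiableAt (by simp)).mdifferentiableAt
  refine (h3.comp q h1).congr_of_eventuallyEq ?_
  filter_upwards [(SphereBundle.coordChart x₀ L).open_source.mem_nhds hq] with q' hq'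
  exact F.unitLift_eq x₀ hq'

/-- The chart of `SM` factors through the lift by the map `r`, and the derivative of a chart is
injective. -/
theorem mvfderiv_unitLift_injective (x₀ : M) {q : SphereBundle m M}
    {L : BaseModel m ≃L[ℝ] ℝ × EuclideanSpace ℝ (Fin m)}
    (hq : q ∈ (SphereBundle.coordChart x₀ L).source) :
    Function.Injective (mvfderiv 𝓘(ℝ, SphereModel m) (F.unitLift x₀) q) := by
  let r : BaseModel m × BaseModel m → SphereModel m := fun w => (w.1, (L w.2).1⁻¹ • (L w.2).2)
  have hr : SphereBundle.coordChart x₀ L = r ∘ F.unitLift x₀ := by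
    funext q'
    obtain ⟨v⟩ := q'
    change ((tangentCoord x₀ v.1).1,
      (L (tangentCoord x₀ v.1).2).1⁻¹ • (L (tangentCoord x₀ v.1).2).2) =
      ((tangentCoord x₀ v.1).1, (L ((F.toFun v.1)⁻¹ • (tangentCoord x₀ v.1).2)).1⁻¹ •
        (L ((F.toFun v.1)⁻¹ • (tangentCoord x₀ v.1).2)).2)
    have hp := (F.pos v.1 v.2).ne'
    simp only [map_smul, Prod.smul_fst, Prod.smul_snd, smul_smul, smul_eq_mul]
    congr 2
    field_simp
  have hne : (L (F.unitLift x₀ q).2).1 ≠ 0 := by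
    obtain ⟨v⟩ := q
    have ht : 0 < (L (tangentCoord x₀ v.1).2).1 := hq.2
    change (L ((F.toFun v.1)⁻¹ • (tangentCoord x₀ v.1).2)).1 ≠ 0
    rw [map_smul]
    exact mul_ne_zero (inv_ne_zero (F.pos v.1 v.2).ne') ht.ne'
  have hrd : DifferentiableAt ℝ r (F.unitLift x₀ q) := by
    have h1 : DifferentiableAt ℝ (fun w : BaseModel m × BaseModel m => (L w.2).1)
      (F.unitLift x₀ q) := by fun_prop
    exact differentiableAt_fst.prodMk ((h1.inv hne).smul (by fun_prop))
  have hinj := (mdifferentiable_of_mem_atlas (I := 𝓘(ℝ, SphereModel m))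
    (SphereBundle.coordChart_mem_atlas x₀ L)).mfderiv_injective hq
  intro v w hvw
  refine hinj ?_
  have h2 := mfderiv_comp_apply q hrd.mdifferentiableAt (F.mdifferentiableAt_unitLift x₀ hq)
  rw [hr, h2 v, h2 w]
  exact congrArg _ hvw

theorem sasaki_apply (p : SphereBundle m M) (X Y : TangentSpace 𝓘(ℝ, SphereModel m) p) :
    F.sasaki p X Y = sasakiLocal (F.inCoord p.proj) (F.unitLift p.proj p).1
      (F.unitLift p.proj p).2 (mvfderiv 𝓘(ℝ, SphereModel m) (F.unitLift p.proj) p X)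
      (mvfderiv 𝓘(ℝ, SphereModel m) (F.unitLift p.proj) p Y) := rfl

/-- The image of the lift `[y] ↦ y / F(y)` is the indicatrix bundle `F = 1`. -/
theorem fderiv_inCoord_mvfderiv_unitLift (x₀ : M) {q : SphereBundle m M}
    {L : BaseModel m ≃L[ℝ] ℝ × EuclideanSpace ℝ (Fin m)}
    (hq : q ∈ (SphereBundle.coordChart x₀ L).source) (X : TangentSpace 𝓘(ℝ, SphereModel m) q) :
    fderiv ℝ (fun w : BaseModel m × BaseModel m => F.inCoord x₀ w.1 w.2) (F.unitLift x₀ q)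
      (mvfderiv 𝓘(ℝ, SphereModel m) (F.unitLift x₀) q X) = 0 := by
  have hs := SphereBundle.proj_mem_source hq
  have h1 := ((F.isLocalFinsler x₀).contDiffAt (F.unitLift_fst_mem x₀ hs)
    (F.unitLift_snd_ne_zero x₀ hs)).differentiableAt (by simp)
  have h2 := mvfderiv_comp_apply q h1.mdifferentiableAt (F.mdifferentiableAt_unitLift x₀ hq) X
  have h3 : mvfderiv 𝓘(ℝ, SphereModel m)
      ((fun w : BaseModel m × BaseModel m => F.inCoord x₀ w.1 w.2) ∘ F.unitLift x₀) q = 0 := by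
    have h4 : HasMFDerivAt 𝓘(ℝ, SphereModel m) 𝓘(ℝ, ℝ)
        ((fun w : BaseModel m × BaseModel m => F.inCoord x₀ w.1 w.2) ∘ F.unitLift x₀) q 0 := by
      refine (hasMFDerivAt_const (1 : ℝ) q).congr_of_eventuallyEq ?_
      filter_upwards [(SphereBundle.coordChart x₀ L).open_source.mem_nhds hq] with q' hq'
      exact F.inCoord_unitLift x₀ (SphereBundle.proj_mem_source hq')
    rw [mvfderiv, h4.mfderiv]
    rfl
  rw [h3] at h2
  rw [mvfderiv, mfderiv_eq_fderiv] at h2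
  exact h2.symm

/-- The derivative of the lift is injective with values tangent to F = 1, where `sasakiLocal_pos`
applies. -/
theorem isDefiniteMetric_sasaki : IsDefiniteMetric F.sasaki where
  symm p X Y := (F.isLocalFinsler p.proj).sasakiLocal_symm
    (F.unitLift_fst_mem _ (mem_chart_source _ _)) (F.unitLift_snd_ne_zero _ (mem_chart_source _ _))
    _ _
  pos p X hX := by
    obtain ⟨L, hL⟩ := SphereBundle.exists_coordChart_proj p
    refine (F.isLocalFinsler p.proj).sasakiLocal_pos
      (F.unitLift_fst_mem _ (mem_chart_source _ _))
      (F.unitLift_snd_ne_zero _ (mem_chart_source _ _))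
      (F.fderiv_inCoord_mvfderiv_unitLift p.proj hL X) fun h => hX ?_
    exact F.mvfderiv_unitLift_injective p.proj hL (by rw [h, map_zero])

end FinslerStructure

end SasakiMetric

/-! ### Smoothness of the Sasaki tensor in natural coordinates -/

section LocalFinslerSmooth

theorem contDiffAt_real_smul {E G : Type*} [NormedAddCommGroup E] [NormedSpace ℝ E]
    [NormedAddCommGroup G] [NormedSpace ℝ G] {n : WithTop ℕ∞} {h : E → G} {x : E} (c : ℝ)
    (hh : ContDiffAt ℝ n h x) : ContDiffAt ℝ n (fun w => c • h w) x :=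
  contDiffAt_const.smul hh

variable {m : ℕ}

namespace IsLocalFinsler

variable {f : BaseModel m → BaseModel m → ℝ} {T : Set (BaseModel m)} (hf : IsLocalFinsler f T)
  {x y : BaseModel m}

include hf

theorem contDiffAt_sq_prod (hx : x ∈ T) (hy : y ≠ 0) :
    ContDiffAt ℝ ∞ (fun w : BaseModel m × BaseModel m => f w.1 w.2 ^ 2) (x, y) :=
  (hf.contDiffAt hx hy).pow 2

/-- A partial derivative is treated as a derivative with parameters: the function is regarded as
depending on the full point and a separate variable, with the redundant coordinate forgotten. The
same device serves for the later partial derivatives in `x` and in `y`. -/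
theorem contDiffAt_fderiv (hx : x ∈ T) (hy : y ≠ 0) :
    ContDiffAt ℝ ∞ (fun w : BaseModel m × BaseModel m => fderiv ℝ (fun v => f w.1 v) w.2)
      (x, y) := by
  refine ContDiffAt.fderiv (n := ∞) (f := fun (w : BaseModel m × BaseModel m) v => f w.1 v)
    ?_ contDiffAt_snd (by simp)
  exact (hf.contDiffAt hx hy).comp
    (f := fun w : (BaseModel m × BaseModel m) × BaseModel m => (w.1.1, w.2)) ((x, y), y)
    (by fun_prop)

theorem contDiffAt_fderiv_sq (hx : x ∈ T) (hy : y ≠ 0) :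
    ContDiffAt ℝ ∞ (fun w : BaseModel m × BaseModel m => fderiv ℝ (fun v => f w.1 v ^ 2) w.2)
      (x, y) := by
  refine ContDiffAt.fderiv (n := ∞) (f := fun (w : BaseModel m × BaseModel m) v => f w.1 v ^ 2)
    ?_ contDiffAt_snd (by simp)
  exact (hf.contDiffAt_sq_prod hx hy).comp
    (f := fun w : (BaseModel m × BaseModel m) × BaseModel m => (w.1.1, w.2)) ((x, y), y)
    (by fun_prop)

theorem contDiffAt_fundamentalTensor (hx : x ∈ T) (hy : y ≠ 0) :
    ContDiffAt ℝ ∞ (fun w : BaseModel m × BaseModel m => fundamentalTensor f w.1 w.2) (x, y) := by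
  have h : ContDiffAt ℝ ∞ (fun w : BaseModel m × BaseModel m =>
      fderiv ℝ (fun v => fderiv ℝ (fun w' => f w.1 w' ^ 2) v) w.2) (x, y) := by
    refine ContDiffAt.fderiv (n := ∞) (f := fun (w : BaseModel m × BaseModel m) v =>
      fderiv ℝ (fun w' => f w.1 w' ^ 2) v) ?_ contDiffAt_snd (by simp)
    exact (hf.contDiffAt_fderiv_sq hx hy).comp
      (f := fun w : (BaseModel m × BaseModel m) × BaseModel m => (w.1.1, w.2)) ((x, y), y)
      (by fun_prop)
  exact contDiffAt_real_smul (1 / 2) h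

theorem contDiffAt_sprayCovector (hx : x ∈ T) (hy : y ≠ 0) :
    ContDiffAt ℝ ∞ (fun w : BaseModel m × BaseModel m => sprayCovector f w.1 w.2) (x, y) := by
  refine ContDiffAt.sub (ContDiffAt.clm_apply ?_ contDiffAt_snd) ?_
  · refine ContDiffAt.fderiv (n := ∞) (f := fun (w : BaseModel m × BaseModel m) b =>
      fderiv ℝ (fun v => f b v ^ 2) w.2) ?_ contDiffAt_fst (by simp)
    exact (hf.contDiffAt_fderiv_sq hx hy).comp
      (f := fun w : (BaseModel m × BaseModel m) × BaseModel m => (w.2, w.1.2)) ((x, y), x)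
      (by fun_prop)
  · refine ContDiffAt.fderiv (n := ∞) (f := fun (w : BaseModel m × BaseModel m) b => f b w.2 ^ 2)
      ?_ contDiffAt_fst (by simp)
    exact (hf.contDiffAt_sq_prod hx hy).comp
      (f := fun w : (BaseModel m × BaseModel m) × BaseModel m => (w.2, w.1.2)) ((x, y), x)
      (by fun_prop)

/-- Positivity gives injectivity, and dimensions agree. Since `ContinuousLinearMap.inverse` has the
default value 0 at noninvertible maps, this is what makes `sprayCoeff` a genuine solution of its
defining equation, and smooth. -/
theorem exists_equiv_fundamentalTensor (hx : x ∈ T) (hy : y ≠ 0) :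
    ∃ e : BaseModel m ≃L[ℝ] (BaseModel m →L[ℝ] ℝ),
      (e : BaseModel m →L[ℝ] (BaseModel m →L[ℝ] ℝ)) = fundamentalTensor f x y := by
  have hinj : Function.Injective (fundamentalTensor f x y).toLinearMap := by
    rw [← LinearMap.ker_eq_bot, LinearMap.ker_eq_bot']
    intro u hu
    by_contra h0
    have hu' : fundamentalTensor f x y u = 0 := hu
    have := hf.posDef x hx y hy u h0
    rw [hu'] at this
    simp at this
  have hdim : Module.finrank ℝ (BaseModel m) = Module.finrank ℝ (BaseModel m →L[ℝ] ℝ) := by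
    rw [← LinearEquiv.finrank_eq
      (LinearMap.toContinuousLinearMap : (BaseModel m →ₗ[ℝ] ℝ) ≃ₗ[ℝ] (BaseModel m →L[ℝ] ℝ))]
    exact (Subspace.dual_finrank_eq (K := ℝ) (V := BaseModel m)).symm
  exact ⟨(LinearEquiv.ofInjectiveOfFinrankEq _ hinj hdim).toContinuousLinearEquiv, by ext; rfl⟩

theorem fundamentalTensor_sprayCoeff (hx : x ∈ T) (hy : y ≠ 0) :
    fundamentalTensor f x y (sprayCoeff f x y) = (1 / 4 : ℝ) • sprayCovector f x y := by
  obtain ⟨e, he⟩ := hf.exists_equiv_fundamentalTensor hx hy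
  rw [sprayCoeff, ← he, ContinuousLinearMap.inverse_equiv]
  exact e.apply_symm_apply _

theorem contDiffAt_sprayCoeff (hx : x ∈ T) (hy : y ≠ 0) :
    ContDiffAt ℝ ∞ (fun w : BaseModel m × BaseModel m => sprayCoeff f w.1 w.2) (x, y) := by
  obtain ⟨e, he⟩ := hf.exists_equiv_fundamentalTensor hx hy
  have h1 : ContDiffAt ℝ ∞ ContinuousLinearMap.inverse (fundamentalTensor f x y) := by
    rw [← he]
    exact contDiffAt_map_inverse e
  exact (h1.comp (x, y) (hf.contDiffAt_fundamentalTensor hx hy)).clm_apply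
    ((hf.contDiffAt_sprayCovector hx hy).const_smul (1 / 4 : ℝ))

theorem contDiffAt_fderiv_sprayCoeff (hx : x ∈ T) (hy : y ≠ 0) :
    ContDiffAt ℝ ∞ (fun w : BaseModel m × BaseModel m =>
      fderiv ℝ (fun v => sprayCoeff f w.1 v) w.2) (x, y) := by
  refine ContDiffAt.fderiv (n := ∞) (f := fun (w : BaseModel m × BaseModel m) v =>
    sprayCoeff f w.1 v) ?_ contDiffAt_snd (by simp)
  exact (hf.contDiffAt_sprayCoeff hx hy).comp
    (f := fun w : (BaseModel m × BaseModel m) × BaseModel m => (w.1.1, w.2)) ((x, y), y)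
    (by fun_prop)

theorem contDiffAt_deltaY (hx : x ∈ T) (hy : y ≠ 0) (ξ : BaseModel m × BaseModel m) :
    ContDiffAt ℝ ∞ (fun w : (BaseModel m × BaseModel m) × (BaseModel m × BaseModel m) =>
      deltaY f w.1.1 w.1.2 w.2) ((x, y), ξ) := by
  have h1 : ContDiffAt ℝ ∞ (fun w : (BaseModel m × BaseModel m) × (BaseModel m × BaseModel m) =>
      f w.1.1 w.1.2) ((x, y), ξ) := (hf.contDiffAt hx hy).comp ((x, y), ξ) contDiffAt_fst
  have h2 : ContDiffAt ℝ ∞ (fun w : (BaseModel m × BaseModel m) × (BaseModel m × BaseModel m) =>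
      fderiv ℝ (fun v => sprayCoeff f w.1.1 v) w.1.2) ((x, y), ξ) :=
    (hf.contDiffAt_fderiv_sprayCoeff hx hy).comp ((x, y), ξ) contDiffAt_fst
  exact (h1.inv (hf.pos x hx y hy).ne').smul
    (ContDiffAt.add (by fun_prop) (h2.clm_apply (by fun_prop)))

/-- The Sasaki tensor depends smoothly on the point and on the two vectors. -/
theorem contDiffAt_sasakiLocal (hx : x ∈ T) (hy : y ≠ 0) (ξ η : BaseModel m × BaseModel m) :
    ContDiffAt ℝ ∞ (fun w : (BaseModel m × BaseModel m) ×
        ((BaseModel m × BaseModel m) × (BaseModel m × BaseModel m)) =>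
      sasakiLocal f w.1.1 w.1.2 w.2.1 w.2.2) ((x, y), (ξ, η)) := by
  have hg : ContDiffAt ℝ ∞ (fun w : (BaseModel m × BaseModel m) ×
        ((BaseModel m × BaseModel m) × (BaseModel m × BaseModel m)) =>
      fundamentalTensor f w.1.1 w.1.2) ((x, y), (ξ, η)) :=
    ContDiffAt.comp (f := Prod.fst) (g := fun w : BaseModel m × BaseModel m =>
      fundamentalTensor f w.1 w.2) ((x, y), (ξ, η)) (hf.contDiffAt_fundamentalTensor hx hy)
      contDiffAt_fst
  have hd : ContDiffAt ℝ ∞ (fun w : (BaseModel m × BaseModel m) ×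
        ((BaseModel m × BaseModel m) × (BaseModel m × BaseModel m)) =>
      fderiv ℝ (fun v => f w.1.1 v) w.1.2) ((x, y), (ξ, η)) :=
    (hf.contDiffAt_fderiv hx hy).comp ((x, y), (ξ, η)) contDiffAt_fst
  have h1 : ContDiffAt ℝ ∞ (fun w : (BaseModel m × BaseModel m) ×
        ((BaseModel m × BaseModel m) × (BaseModel m × BaseModel m)) =>
      deltaY f w.1.1 w.1.2 w.2.1) ((x, y), (ξ, η)) :=
    (hf.contDiffAt_deltaY hx hy ξ).comp (f := fun w : (BaseModel m × BaseModel m) ×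
        ((BaseModel m × BaseModel m) × (BaseModel m × BaseModel m)) => (w.1, w.2.1))
      ((x, y), (ξ, η)) (by fun_prop)
  have h2 : ContDiffAt ℝ ∞ (fun w : (BaseModel m × BaseModel m) ×
        ((BaseModel m × BaseModel m) × (BaseModel m × BaseModel m)) =>
      deltaY f w.1.1 w.1.2 w.2.2) ((x, y), (ξ, η)) :=
    (hf.contDiffAt_deltaY hx hy η).comp (f := fun w : (BaseModel m × BaseModel m) ×
        ((BaseModel m × BaseModel m) × (BaseModel m × BaseModel m)) => (w.1, w.2.2))
      ((x, y), (ξ, η)) (by fun_prop)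
  exact ((hg.clm_apply (by fun_prop)).clm_apply (by fun_prop)).add
    (((hg.clm_apply h1).clm_apply h2).sub ((hd.clm_apply h1).mul (hd.clm_apply h2)))

end IsLocalFinsler

end LocalFinslerSmooth

/-! ### Derivatives of a tangent map and of compositions with it -/

section PartialDerivatives

variable {E G : Type*} [NormedAddCommGroup E] [NormedSpace ℝ E] [NormedAddCommGroup G]
  [NormedSpace ℝ G]

theorem fderiv_prod_apply {Q : E × E → G} {X Y : E} (hQ : DifferentiableAt ℝ Q (X, Y))
    (a b : E) :
    fderiv ℝ Q (X, Y) (a, b) =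
      fderiv ℝ (fun z => Q (z, Y)) X a + fderiv ℝ (fun z => Q (X, z)) Y b := by
  have h1 : HasFDerivAt (fun z => Q (z, Y)) _ X := hQ.hasFDerivAt.comp (f := fun z => (z, Y)) X
    ((hasFDerivAt_id X).prodMk (hasFDerivAt_const Y X))
  have h2 : HasFDerivAt (fun z => Q (X, z)) _ Y := hQ.hasFDerivAt.comp (f := fun z => (X, z)) Y
    ((hasFDerivAt_const X Y).prodMk (hasFDerivAt_id Y))
  rw [h1.fderiv, h2.fderiv]
  simp only [ContinuousLinearMap.comp_apply, ContinuousLinearMap.prod_apply, zero_apply,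
    ContinuousLinearMap.id_apply]
  rw [← map_add]
  simp

theorem hasFDerivAt_prodMk_fderiv_apply {φ : E → E} {x : E} (hφ : ContDiffAt ℝ ∞ φ x) (y : E) :
    HasFDerivAt (fun b => (φ b, fderiv ℝ φ b y))
      ((fderiv ℝ φ x).prod ((fderiv ℝ (fderiv ℝ φ) x).flip y)) x := by
  have h1 := (hφ.differentiableAt (by simp)).hasFDerivAt
  have h2 := ((hφ.fderiv_right (m := 1) (by norm_cast)).differentiableAt one_ne_zero).hasFDerivAt
  refine h1.prodMk ?_
  have h3 := h2.clm_apply (hasFDerivAt_const y x)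
  simpa using h3

theorem hasFDerivAt_tangentMap {φ : E → E} {x : E} (hφ : ContDiffAt ℝ ∞ φ x) (y : E) :
    HasFDerivAt (fun w : E × E => (φ w.1, fderiv ℝ φ w.1 w.2))
      (((fderiv ℝ φ x).comp (ContinuousLinearMap.fst ℝ E E)).prod
        ((fderiv ℝ φ x).comp (ContinuousLinearMap.snd ℝ E E) +
          ((fderiv ℝ (fderiv ℝ φ) x).flip y).comp (ContinuousLinearMap.fst ℝ E E))) (x, y) := by
  have h1 := (hφ.differentiableAt (by simp)).hasFDerivAt.comp (x, y)
    (hasFDerivAt_fst (𝕜 := ℝ) (p := (x, y)))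
  have h2 := ((hφ.fderiv_right (m := 1) (by norm_cast)).differentiableAt
    one_ne_zero).hasFDerivAt.comp (x, y) (hasFDerivAt_fst (𝕜 := ℝ) (p := (x, y)))
  exact h1.prodMk (h2.clm_apply (hasFDerivAt_snd (𝕜 := ℝ) (p := (x, y))))

/-- Although `y` is fixed, its image under the derivative of `φ` at `b` moves with `b`. This is the
source of every second derivative of `φ` in the transformation laws. -/
theorem fderiv_comp_tangentMap {φ : E → E} {x y : E} (hφ : ContDiffAt ℝ ∞ φ x) {Q : E × E → G}
    (hQ : DifferentiableAt ℝ Q (φ x, fderiv ℝ φ x y)) (u : E) :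
    fderiv ℝ (fun b => Q (φ b, fderiv ℝ φ b y)) x u =
      fderiv ℝ (fun z => Q (z, fderiv ℝ φ x y)) (φ x) (fderiv ℝ φ x u) +
        fderiv ℝ (fun z => Q (φ x, z)) (fderiv ℝ φ x y) (fderiv ℝ (fderiv ℝ φ) x u y) := by
  have h1 : HasFDerivAt (fun b => Q (φ b, fderiv ℝ φ b y)) _ x :=
    HasFDerivAt.comp (f := fun b => (φ b, fderiv ℝ φ b y)) x hQ.hasFDerivAt
      (hasFDerivAt_prodMk_fderiv_apply hφ y)
  rw [h1.fderiv, ← fderiv_prod_apply hQ]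
  rfl

end PartialDerivatives

/-! ### Transformation laws under a change of coordinates -/

section CoordinateChange

variable {m : ℕ}

/-- `f₀` and `f₁` are the expressions of a Finsler function in two natural coordinate systems
`(x, y)`, with the transition map `φ` of the coordinates `x`. -/
structure IsFinslerCoordChange (f₀ f₁ : BaseModel m → BaseModel m → ℝ) (T₀ T₁ : Set (BaseModel m))
    (φ : BaseModel m → BaseModel m) (S : Set (BaseModel m)) : Prop where
  isLocalFinsler₀ : IsLocalFinsler f₀ T₀
  isLocalFinsler₁ : IsLocalFinsler f₁ T₁
  isOpen : IsOpen S
  subset : S ⊆ T₀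
  mapsTo : MapsTo φ S T₁
  smooth : ContDiffOn ℝ ∞ φ S
  injective : ∀ x ∈ S, Function.Injective (fderiv ℝ φ x)
  eq : ∀ x ∈ S, ∀ y ≠ 0, f₀ x y = f₁ (φ x) (fderiv ℝ φ x y)

namespace IsFinslerCoordChange

variable {f₀ f₁ : BaseModel m → BaseModel m → ℝ} {T₀ T₁ : Set (BaseModel m)}
    {φ : BaseModel m → BaseModel m} {S : Set (BaseModel m)}
    (h : IsFinslerCoordChange f₀ f₁ T₀ T₁ φ S) {x y : BaseModel m}

include h

theorem contDiffAt (hx : x ∈ S) : ContDiffAt ℝ ∞ φ x :=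
  h.smooth.contDiffAt (h.isOpen.mem_nhds hx)

theorem fderiv_ne_zero (hx : x ∈ S) (hy : y ≠ 0) : fderiv ℝ φ x y ≠ 0 := fun h0 =>
  hy (h.injective x hx (by rw [h0, map_zero]))

/-- With `x` fixed the change of coordinates is linear in `y`. So fibre derivatives, including the
fundamental tensor below, transform without second derivatives of `φ`. -/
theorem fderiv_eq (hx : x ∈ S) (hy : y ≠ 0) (u : BaseModel m) :
    fderiv ℝ (fun w => f₀ x w) y u =
      fderiv ℝ (fun w => f₁ (φ x) w) (fderiv ℝ φ x y) (fderiv ℝ φ x u) := by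
  have h1 : HasFDerivAt (fun w => f₁ (φ x) (fderiv ℝ φ x w)) _ y :=
    ((h.isLocalFinsler₁.contDiffAt_fiber (h.mapsTo hx)
      (h.fderiv_ne_zero hx hy)).differentiableAt (by simp)).hasFDerivAt.comp y
      (fderiv ℝ φ x).hasFDerivAt
  have h2 : (fun w => f₀ x w) =ᶠ[𝓝 y] fun w => f₁ (φ x) (fderiv ℝ φ x w) := by
    filter_upwards [isOpen_compl_singleton.mem_nhds hy] with w hw
    exact h.eq x hx w hw
  rw [h2.fderiv_eq, h1.fderiv]
  rfl

theorem fderiv_sq_eq (hx : x ∈ S) (hy : y ≠ 0) (u : BaseModel m) :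
    fderiv ℝ (fun w => f₀ x w ^ 2) y u =
      fderiv ℝ (fun w => f₁ (φ x) w ^ 2) (fderiv ℝ φ x y) (fderiv ℝ φ x u) := by
  rw [h.isLocalFinsler₀.fderiv_sq (h.subset hx) hy,
    h.isLocalFinsler₁.fderiv_sq (h.mapsTo hx) (h.fderiv_ne_zero hx hy), h.fderiv_eq hx hy,
    h.eq x hx y hy]

theorem fundamentalTensor_eq (hx : x ∈ S) (hy : y ≠ 0) (u v : BaseModel m) :
    fundamentalTensor f₀ x y u v =
      fundamentalTensor f₁ (φ x) (fderiv ℝ φ x y) (fderiv ℝ φ x u) (fderiv ℝ φ x v) := by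
  have h0 := (h.isLocalFinsler₀.differentiableAt_fderiv_sq (h.subset hx) hy).hasFDerivAt.clm_apply
    (hasFDerivAt_const v y)
  have h1 := ((h.isLocalFinsler₁.differentiableAt_fderiv_sq (h.mapsTo hx)
    (h.fderiv_ne_zero hx hy)).hasFDerivAt.comp y (fderiv ℝ φ x).hasFDerivAt).clm_apply
    (hasFDerivAt_const (fderiv ℝ φ x v) y)
  have h2 := h0.unique (h1.congr_of_eventuallyEq (by
    filter_upwards [isOpen_compl_singleton.mem_nhds hy] with w hw
    exact h.fderiv_sq_eq hx hw v))
  have h3 := congrArg (fun A => A u) h2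
  simp only [fundamentalTensor, smul_apply, smul_eq_mul]
  simpa using h3

/-- Each of the two terms of the covector produces a term [F²]_y(D²φ(y, v)), and these cancel
because D²φ is symmetric. The remaining correction arises because the point at which [F²]_y is
evaluated moves by D²φ(y, y). -/
theorem sprayCovector_eq (hx : x ∈ S) (hy : y ≠ 0) (v : BaseModel m) :
    sprayCovector f₀ x y v = sprayCovector f₁ (φ x) (fderiv ℝ φ x y) (fderiv ℝ φ x v) +
      2 * fundamentalTensor f₁ (φ x) (fderiv ℝ φ x y) (fderiv ℝ (fderiv ℝ φ) x y y)
        (fderiv ℝ φ x v) := by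
  have hy' := h.fderiv_ne_zero hx hy
  have hx' := h.mapsTo hx
  have hφ := h.contDiffAt hx
  have hB : fderiv ℝ (fderiv ℝ φ) x v y = fderiv ℝ (fderiv ℝ φ) x y v :=
    (hφ.isSymmSndFDerivAt
      (by rw [minSmoothness_of_isRCLikeNormedField]; exact WithTop.coe_le_coe.2 le_top)).eq v y
  have e1 : fderiv ℝ (fun b => f₀ b y ^ 2) x v =
      fderiv ℝ (fun b => f₁ b (fderiv ℝ φ x y) ^ 2) (φ x) (fderiv ℝ φ x v) +
      fderiv ℝ (fun w => f₁ (φ x) w ^ 2) (fderiv ℝ φ x y) (fderiv ℝ (fderiv ℝ φ) x v y) := by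
    have h2 : (fun b => f₀ b y ^ 2) =ᶠ[𝓝 x] fun b => f₁ (φ b) (fderiv ℝ φ b y) ^ 2 := by
      filter_upwards [h.isOpen.mem_nhds hx] with b hb
      rw [h.eq b hb y hy]
    rw [h2.fderiv_eq]
    exact fderiv_comp_tangentMap (Q := fun w => f₁ w.1 w.2 ^ 2) hφ
      ((h.isLocalFinsler₁.contDiffAt_sq_prod hx' hy').differentiableAt (by simp)) v
  have e2 : fderiv ℝ (fun b => fderiv ℝ (fun w => f₀ b w ^ 2) y) x y v =
      fderiv ℝ (fun b => fderiv ℝ (fun w => f₁ b w ^ 2) (fderiv ℝ φ x y)) (φ x)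
        (fderiv ℝ φ x y) (fderiv ℝ φ x v) +
      fderiv ℝ (fun z => fderiv ℝ (fun w => f₁ (φ x) w ^ 2) z) (fderiv ℝ φ x y)
        (fderiv ℝ (fderiv ℝ φ) x y y) (fderiv ℝ φ x v) +
      fderiv ℝ (fun w => f₁ (φ x) w ^ 2) (fderiv ℝ φ x y) (fderiv ℝ (fderiv ℝ φ) x y v) := by
    have d0 : DifferentiableAt ℝ (fun b => fderiv ℝ (fun w => f₀ b w ^ 2) y) x :=
      DifferentiableAt.comp (f := fun b => (b, y)) x
        ((h.isLocalFinsler₀.contDiffAt_fderiv_sq (h.subset hx) hy).differentiableAt (by simp))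
        (by fun_prop)
    have dQ : DifferentiableAt ℝ (fun w : BaseModel m × BaseModel m =>
        fderiv ℝ (fun v => f₁ w.1 v ^ 2) w.2) (φ x, fderiv ℝ φ x y) :=
      (h.isLocalFinsler₁.contDiffAt_fderiv_sq hx' hy').differentiableAt (by simp)
    have dφ : HasFDerivAt (fun b => fderiv ℝ φ b v) ((fderiv ℝ (fderiv ℝ φ) x).flip v) x := by
      have := (hasFDerivAt_prodMk_fderiv_apply hφ v).snd
      simpa using this
    have d1 : DifferentiableAt ℝ (fun b => fderiv ℝ (fun w => f₁ (φ b) w ^ 2) (fderiv ℝ φ b y)) x :=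
      DifferentiableAt.comp (f := fun b => (φ b, fderiv ℝ φ b y)) x dQ
        (hasFDerivAt_prodMk_fderiv_apply hφ y).differentiableAt
    have h0 := d0.hasFDerivAt.clm_apply (hasFDerivAt_const v x)
    have h1 := d1.hasFDerivAt.clm_apply dφ
    have h2 := h0.unique (h1.congr_of_eventuallyEq (by
      filter_upwards [h.isOpen.mem_nhds hx] with b hb
      exact h.fderiv_sq_eq hb hy v))
    have h3 := congrArg (fun A => A y) h2
    have h4 := congrArg (fun A => A (fderiv ℝ φ x v)) (fderiv_comp_tangentMap hφ dQ y)
    simp only [add_apply] at h4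
    rw [← h4]
    simpa [add_comm] using h3
  simp only [sprayCovector, fundamentalTensor, sub_apply, smul_apply, smul_eq_mul]
  rw [e1, e2, hB]
  ring

/-- The transformation law of the spray coefficients. -/
theorem sprayCoeff_eq (hx : x ∈ S) (hy : y ≠ 0) :
    fderiv ℝ φ x (sprayCoeff f₀ x y) = sprayCoeff f₁ (φ x) (fderiv ℝ φ x y) +
      (1 / 2 : ℝ) • fderiv ℝ (fderiv ℝ φ) x y y := by
  have hy' := h.fderiv_ne_zero hx hy
  have hx' := h.mapsTo hx
  -- The identity is tested with g against image vectors; the constant 1/2 is the 1/4 of the spray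
  -- times the 2 of `sprayCovector_eq`.
  have h1 : ∀ v, fundamentalTensor f₁ (φ x) (fderiv ℝ φ x y)
      (fderiv ℝ φ x (sprayCoeff f₀ x y) - (sprayCoeff f₁ (φ x) (fderiv ℝ φ x y) +
      (1 / 2 : ℝ) • fderiv ℝ (fderiv ℝ φ) x y y)) (fderiv ℝ φ x v) = 0 := by
    intro v
    have h2 := congrArg (fun A => A v)
      (h.isLocalFinsler₀.fundamentalTensor_sprayCoeff (h.subset hx) hy)
    have h3 := congrArg (fun A => A (fderiv ℝ φ x v))
      (h.isLocalFinsler₁.fundamentalTensor_sprayCoeff hx' hy')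
    simp only [smul_apply, smul_eq_mul] at h2 h3
    rw [h.fundamentalTensor_eq hx hy, h.sprayCovector_eq hx hy] at h2
    simp only [map_sub, map_add, map_smul, sub_apply, add_apply, smul_apply, smul_eq_mul]
    rw [h2, h3]
    ring
  -- All vectors are image vectors, so the difference can be paired with itself.
  have hsurj : Function.Surjective (fderiv ℝ φ x) :=
    (LinearMap.injective_iff_surjective (f := (fderiv ℝ φ x).toLinearMap)).1 (h.injective x hx)
  by_contra h0
  obtain ⟨v, hv⟩ := hsurj (fderiv ℝ φ x (sprayCoeff f₀ x y) -
    (sprayCoeff f₁ (φ x) (fderiv ℝ φ x y) + (1 / 2 : ℝ) • fderiv ℝ (fderiv ℝ φ) x y y))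
  have h2 := h1 v
  rw [hv] at h2
  exact (h.isLocalFinsler₁.posDef _ hx' _ hy' _ (sub_ne_zero.2 h0)).ne' h2

/-- The transformation law of the nonlinear connection. -/
theorem fderiv_sprayCoeff_eq (hx : x ∈ S) (hy : y ≠ 0) (u : BaseModel m) :
    fderiv ℝ φ x (fderiv ℝ (fun w => sprayCoeff f₀ x w) y u) =
      fderiv ℝ (fun w => sprayCoeff f₁ (φ x) w) (fderiv ℝ φ x y) (fderiv ℝ φ x u) +
      fderiv ℝ (fderiv ℝ φ) x u y := by
  have hy' := h.fderiv_ne_zero hx hy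
  have hx' := h.mapsTo hx
  have hφ := h.contDiffAt hx
  have hB : fderiv ℝ (fderiv ℝ φ) x y u = fderiv ℝ (fderiv ℝ φ) x u y :=
    (hφ.isSymmSndFDerivAt
      (by rw [minSmoothness_of_isRCLikeNormedField]; exact WithTop.coe_le_coe.2 le_top)).eq y u
  have d0 : DifferentiableAt ℝ (fun w => sprayCoeff f₀ x w) y :=
    DifferentiableAt.comp (f := fun w => (x, w)) y
      ((h.isLocalFinsler₀.contDiffAt_sprayCoeff (h.subset hx) hy).differentiableAt (by simp))
      (by fun_prop)
  have d1 : DifferentiableAt ℝ (fun w => sprayCoeff f₁ (φ x) w) (fderiv ℝ φ x y) :=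
    DifferentiableAt.comp (f := fun w => (φ x, w)) (fderiv ℝ φ x y)
      ((h.isLocalFinsler₁.contDiffAt_sprayCoeff hx' hy').differentiableAt (by simp))
      (by fun_prop)
  have h0 := (fderiv ℝ φ x).hasFDerivAt.comp y d0.hasFDerivAt
  have h1 := d1.hasFDerivAt.comp y (fderiv ℝ φ x).hasFDerivAt
  have h2 := ((fderiv ℝ (fderiv ℝ φ) x).hasFDerivAt.clm_apply (hasFDerivAt_id y)).const_smul
    (1 / 2 : ℝ)
  have h3 := h0.unique ((h1.add h2).congr_of_eventuallyEq (by
    filter_upwards [isOpen_compl_singleton.mem_nhds hy] with w hw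
    exact h.sprayCoeff_eq hx hw))
  have h4 := congrArg (fun A => A u) h3
  simp only [ContinuousLinearMap.comp_apply, add_apply, smul_apply,
    ContinuousLinearMap.flip_apply, id_eq, ContinuousLinearMap.id_apply, hB] at h4
  -- Differentiating the quadratic map D²φ(w, w) / 2 yields two equal halves, by the symmetry `hB`.
  rw [h4, ← two_smul ℝ, smul_smul]
  norm_num

/-- The components of `δy` transform like those of a tangent vector of the base. -/
theorem deltaY_eq (hx : x ∈ S) (hy : y ≠ 0) (ξ : BaseModel m × BaseModel m) :
    fderiv ℝ φ x (deltaY f₀ x y ξ) = deltaY f₁ (φ x) (fderiv ℝ φ x y)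
      (fderiv ℝ φ x ξ.1, fderiv ℝ φ x ξ.2 + fderiv ℝ (fderiv ℝ φ) x ξ.1 y) := by
  simp only [deltaY, map_smul, map_add]
  -- The second derivative of `φ` in the law of the nonlinear connection is exactly the one in the
  -- transformed `dy` component.
  rw [h.fderiv_sprayCoeff_eq hx hy, h.eq x hx y hy]
  congr 1
  abel

/-- The Sasaki tensor does not depend on the coordinates. -/
theorem sasakiLocal_eq (hx : x ∈ S) (hy : y ≠ 0) (ξ η : BaseModel m × BaseModel m) :
    sasakiLocal f₀ x y ξ η = sasakiLocal f₁ (φ x) (fderiv ℝ φ x y)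
      (fderiv ℝ φ x ξ.1, fderiv ℝ φ x ξ.2 + fderiv ℝ (fderiv ℝ φ) x ξ.1 y)
      (fderiv ℝ φ x η.1, fderiv ℝ φ x η.2 + fderiv ℝ (fderiv ℝ φ) x η.1 y) := by
  simp only [sasakiLocal]
  rw [h.fundamentalTensor_eq hx hy, h.fundamentalTensor_eq hx hy, h.fderiv_eq hx hy,
    h.fderiv_eq hx hy, h.deltaY_eq hx hy, h.deltaY_eq hx hy]

end IsFinslerCoordChange

end CoordinateChange

/-! ### Independence of the chart and differentiability of the Sasaki metric -/

section ChartTransition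

variable {m : ℕ} {M : Type*} [TopologicalSpace M] [ChartedSpace (BaseModel m) M]

/-- The transition map between the coordinates of `M` around `x₀` and around `x₁`. -/
noncomputable def chartTransition (x₀ x₁ : M) : BaseModel m → BaseModel m :=
  fun x => chartAt (BaseModel m) x₁ ((chartAt (BaseModel m) x₀).symm x)

/-- The domain of `chartTransition x₀ x₁`. -/
def chartTransitionSource (x₀ x₁ : M) : Set (BaseModel m) :=
  ((chartAt (BaseModel m) x₀).symm.trans (chartAt (BaseModel m) x₁)).source

theorem mem_chartTransitionSource {x₀ x₁ : M} {x : BaseModel m} :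
    x ∈ chartTransitionSource x₀ x₁ ↔ x ∈ (chartAt (BaseModel m) x₀).target ∧
      (chartAt (BaseModel m) x₀).symm x ∈ (chartAt (BaseModel m) x₁).source := by
  simp [chartTransitionSource]

theorem isOpen_chartTransitionSource (x₀ x₁ : M) :
    IsOpen (chartTransitionSource (m := m) x₀ x₁) :=
  ((chartAt (BaseModel m) x₀).symm.trans (chartAt (BaseModel m) x₁)).open_source

theorem chart_mem_chartTransitionSource {x₀ x₁ z : M}
    (h₀ : z ∈ (chartAt (BaseModel m) x₀).source) (h₁ : z ∈ (chartAt (BaseModel m) x₁).source) :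
    chartAt (BaseModel m) x₀ z ∈ chartTransitionSource x₀ x₁ := by
  rw [mem_chartTransitionSource, (chartAt (BaseModel m) x₀).left_inv h₀]
  exact ⟨(chartAt (BaseModel m) x₀).map_source h₀, h₁⟩

theorem chartTransition_chartTransition {x₀ x₁ : M} {x : BaseModel m}
    (hx : x ∈ chartTransitionSource x₀ x₁) :
    chartTransition x₁ x₀ (chartTransition x₀ x₁ x) = x := by
  rw [mem_chartTransitionSource] at hx
  rw [chartTransition, chartTransition, (chartAt (BaseModel m) x₁).left_inv hx.2,
    (chartAt (BaseModel m) x₀).right_inv hx.1]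

theorem chartTransition_mem {x₀ x₁ : M} {x : BaseModel m}
    (hx : x ∈ chartTransitionSource x₀ x₁) :
    chartTransition x₀ x₁ x ∈ chartTransitionSource x₁ x₀ := by
  rw [mem_chartTransitionSource] at hx ⊢
  refine ⟨(chartAt (BaseModel m) x₁).map_source hx.2, ?_⟩
  rw [chartTransition, (chartAt (BaseModel m) x₁).left_inv hx.2]
  exact (chartAt (BaseModel m) x₀).map_target hx.1

variable [IsManifold (𝓡 (m + 1)) ∞ M]

theorem contDiffOn_chartTransition (x₀ x₁ : M) :
    ContDiffOn ℝ ∞ (chartTransition (m := m) x₀ x₁) (chartTransitionSource x₀ x₁) := by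
  have h := contDiffOn_ext_coord_change (n := ∞) (I := 𝓡 (m + 1)) x₁ x₀
  refine h.congr_mono (fun w _ => rfl) ?_
  intro w hw
  rw [ext_coord_change_source]
  exact ⟨w, hw, rfl⟩

/-- The derivative of the reverse transition is a left inverse, by the chain rule. -/
theorem fderiv_chartTransition_injective {x₀ x₁ : M} {x : BaseModel m}
    (hx : x ∈ chartTransitionSource x₀ x₁) :
    Function.Injective (fderiv ℝ (chartTransition (m := m) x₀ x₁) x) := by
  have h1 := (((contDiffOn_chartTransition x₀ x₁).contDiffAt
    ((isOpen_chartTransitionSource x₀ x₁).mem_nhds hx)).differentiableAt (by simp)).hasFDerivAt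
  have h2 := (((contDiffOn_chartTransition x₁ x₀).contDiffAt
    ((isOpen_chartTransitionSource x₁ x₀).mem_nhds
      (chartTransition_mem hx))).differentiableAt (by simp)).hasFDerivAt
  have h3 := (h2.comp x h1).unique ((hasFDerivAt_id x).congr_of_eventuallyEq (by
    filter_upwards [(isOpen_chartTransitionSource x₀ x₁).mem_nhds hx] with z hz
    exact chartTransition_chartTransition hz))
  intro u v huv
  have h4 : ∀ u, fderiv ℝ (chartTransition (m := m) x₁ x₀) (chartTransition x₀ x₁ x)
      (fderiv ℝ (chartTransition (m := m) x₀ x₁) x u) = u := fun u => congrArg (fun A => A u) h3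
  rw [← h4 u, huv, h4 v]

/-- The transition map of the natural coordinates of `TM`. -/
theorem tangentCoord_snd_eq {x₀ x₁ : M} {v : TangentBundle (𝓡 (m + 1)) M}
    (h₀ : v.proj ∈ (chartAt (BaseModel m) x₀).source)
    (h₁ : v.proj ∈ (chartAt (BaseModel m) x₁).source) :
    (tangentCoord x₁ v).2 = fderiv ℝ (chartTransition x₀ x₁) (chartAt (BaseModel m) x₀ v.proj)
      (tangentCoord x₀ v).2 := by
  -- Both coordinate vectors of `v` are obtained from the preferred chart at `v.proj`, so the
  -- cocycle identity relates them.
  have h2 := (tangentBundleCore (𝓡 (m + 1)) M).coordChange_comp (achart (BaseModel m) v.proj)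
    (achart (BaseModel m) x₀) (achart (BaseModel m) x₁) v.proj
    ⟨⟨mem_chart_source _ _, h₀⟩, h₁⟩ v.2
  refine h2.symm.trans ?_
  rw [tangentBundleCore_coordChange, modelWithCornersSelf_coe, Set.range_id, fderivWithin_univ]
  rfl

theorem tangentCoord_tangentCoord_symm {x₀ x₁ : M} {x : BaseModel m}
    (hx : x ∈ chartTransitionSource x₀ x₁) (y : BaseModel m) :
    tangentCoord x₁ ((tangentCoord x₀).symm (x, y)) =
      (chartTransition x₀ x₁ x, fderiv ℝ (chartTransition x₀ x₁) x y) := by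
  have hx' := mem_chartTransitionSource.1 hx
  have hw : (x, y) ∈ (tangentCoord x₀).target := (mem_tangentCoord_target x₀ _).2 hx'.1
  have h0 := (mem_tangentCoord_source x₀ _).1 ((tangentCoord x₀).map_target hw)
  have hr := (tangentCoord x₀).right_inv hw
  have hp : chartAt (BaseModel m) x₀ ((tangentCoord x₀).symm (x, y)).proj = x :=
    congrArg Prod.fst hr
  have hp' : ((tangentCoord x₀).symm (x, y)).proj = (chartAt (BaseModel m) x₀).symm x := by
    rw [← (chartAt (BaseModel m) x₀).left_inv h0, hp]
  refine Prod.ext ?_ ?_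
  · rw [tangentCoord_fst, hp']
    rfl
  · rw [tangentCoord_snd_eq h0 (by rw [hp']; exact hx'.2), hr, hp]

namespace FinslerStructure

variable (F : FinslerStructure m M)

theorem isFinslerCoordChange (x₀ x₁ : M) :
    IsFinslerCoordChange (F.inCoord x₀) (F.inCoord x₁) (chartAt (BaseModel m) x₀).target
      (chartAt (BaseModel m) x₁).target (chartTransition x₀ x₁)
      (chartTransitionSource x₀ x₁) where
  isLocalFinsler₀ := F.isLocalFinsler x₀
  isLocalFinsler₁ := F.isLocalFinsler x₁
  isOpen := isOpen_chartTransitionSource x₀ x₁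
  subset x hx := (mem_chartTransitionSource.1 hx).1
  mapsTo x hx := (mem_chartTransitionSource.1 (chartTransition_mem hx)).1
  smooth := contDiffOn_chartTransition x₀ x₁
  injective x hx := fderiv_chartTransition_injective hx
  eq x hx y _ := by
    have hx' := mem_chartTransitionSource.1 hx
    have hw : (x, y) ∈ (tangentCoord x₀).target := (mem_tangentCoord_target x₀ _).2 hx'.1
    have h1 := tangentCoord_tangentCoord_symm hx y
    have h2 : (tangentCoord x₀).symm (x, y) ∈ (tangentCoord x₁).source := by
      rw [mem_tangentCoord_source]
      have h0 := (mem_tangentCoord_source x₀ _).1 ((tangentCoord x₀).map_target hw)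
      have hp : chartAt (BaseModel m) x₀ ((tangentCoord x₀).symm (x, y)).proj = x :=
        congrArg Prod.fst ((tangentCoord x₀).right_inv hw)
      rw [← (chartAt (BaseModel m) x₀).left_inv h0, hp]
      exact hx'.2
    rw [inCoord, inCoord, ← h1, (tangentCoord x₁).left_inv h2]

theorem unitLift_chartTransition {x₀ x₁ : M} {q : SphereBundle m M}
    (h₀ : q.proj ∈ (chartAt (BaseModel m) x₀).source)
    (h₁ : q.proj ∈ (chartAt (BaseModel m) x₁).source) :
    F.unitLift x₁ q = (chartTransition x₀ x₁ (F.unitLift x₀ q).1,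
      fderiv ℝ (chartTransition x₀ x₁) (F.unitLift x₀ q).1 (F.unitLift x₀ q).2) := by
  refine Prod.ext ?_ ?_
  · simp only [unitLift_fst, chartTransition, (chartAt (BaseModel m) x₀).left_inv h₀]
  · simp only [unitLift_fst]
    obtain ⟨v⟩ := q
    change (F.toFun v.1)⁻¹ • (tangentCoord x₁ v.1).2 =
      fderiv ℝ (chartTransition x₀ x₁) (chartAt (BaseModel m) x₀ v.1.proj)
        ((F.toFun v.1)⁻¹ • (tangentCoord x₀ v.1).2)
    rw [map_smul, tangentCoord_snd_eq h₀ h₁]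

/-- The Sasaki metric can be computed in all the natural coordinates. -/
theorem sasaki_eq {x₀ : M} {L : BaseModel m ≃L[ℝ] ℝ × EuclideanSpace ℝ (Fin m)}
    {q : SphereBundle m M} (hq : q ∈ (SphereBundle.coordChart x₀ L).source)
    (X Y : TangentSpace 𝓘(ℝ, SphereModel m) q) :
    F.sasaki q X Y = sasakiLocal (F.inCoord x₀) (F.unitLift x₀ q).1
      (F.unitLift x₀ q).2 (mvfderiv 𝓘(ℝ, SphereModel m) (F.unitLift x₀) q X)
      (mvfderiv 𝓘(ℝ, SphereModel m) (F.unitLift x₀) q Y) := by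
  have h₀ := SphereBundle.proj_mem_source hq
  have h₁ : q.proj ∈ (chartAt (BaseModel m) q.proj).source := mem_chart_source _ _
  have hS : (F.unitLift x₀ q).1 ∈ chartTransitionSource x₀ q.proj := by
    rw [unitLift_fst]
    exact chart_mem_chartTransitionSource h₀ h₁
  -- The centre `q.proj` stays fixed while differentiating. Near `q` the two lifts differ by the
  -- tangent map of the transition, whose derivative supplies the second-order term expected by
  -- `sasakiLocal_eq`.
  have hd : ∀ X : TangentSpace 𝓘(ℝ, SphereModel m) q,
      mvfderiv 𝓘(ℝ, SphereModel m) (F.unitLift q.proj) q X =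
      (fderiv ℝ (chartTransition x₀ q.proj) (F.unitLift x₀ q).1
          (mvfderiv 𝓘(ℝ, SphereModel m) (F.unitLift x₀) q X).1,
        fderiv ℝ (chartTransition x₀ q.proj) (F.unitLift x₀ q).1
          (mvfderiv 𝓘(ℝ, SphereModel m) (F.unitLift x₀) q X).2 +
        fderiv ℝ (fderiv ℝ (chartTransition x₀ q.proj)) (F.unitLift x₀ q).1
          (mvfderiv 𝓘(ℝ, SphereModel m) (F.unitLift x₀) q X).1 (F.unitLift x₀ q).2) := by
    intro X
    have hΦ := hasFDerivAt_tangentMap ((contDiffOn_chartTransition x₀ q.proj).contDiffAt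
      ((isOpen_chartTransitionSource x₀ q.proj).mem_nhds hS)) (F.unitLift x₀ q).2
    have h2 := (hΦ.hasMFDerivAt.comp q
      (F.mdifferentiableAt_unitLift x₀ hq).hasMFDerivAt).congr_of_eventuallyEq
      (f₁ := F.unitLift q.proj) (by
        filter_upwards [(SphereBundle.coordChart x₀ L).open_source.mem_nhds hq,
          (SphereBundle.mdifferentiableAt_proj q).continuousAt
            (chart_source_mem_nhds (BaseModel m) q.proj)] with q' hq' hq''
        exact F.unitLift_chartTransition (SphereBundle.proj_mem_source hq') hq'')
    rw [mvfderiv, h2.mfderiv]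
    rfl
  rw [sasaki_apply, (F.isFinslerCoordChange x₀ q.proj).sasakiLocal_eq hS
    (F.unitLift_snd_ne_zero x₀ h₀), ← hd, ← hd, F.unitLift_chartTransition h₀ h₁]

/-- The chain rule through the chart separates a smooth map between vector spaces from the
components of `X`, through which differentiability of a vector field is expressed. -/
theorem mvfderiv_unitLift (x₀ : M) {L : BaseModel m ≃L[ℝ] ℝ × EuclideanSpace ℝ (Fin m)}
    {q : SphereBundle m M} (hq : q ∈ (SphereBundle.coordChart x₀ L).source)
    (X : TangentSpace 𝓘(ℝ, SphereModel m) q) :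
    mvfderiv 𝓘(ℝ, SphereModel m) (F.unitLift x₀) q X =
      fderiv ℝ (F.unitLiftInCoord x₀ L) (SphereBundle.coordChart x₀ L q)
        (mvfderiv 𝓘(ℝ, SphereModel m) (SphereBundle.coordChart x₀ L) q X) := by
  have h1 : MDifferentiableAt 𝓘(ℝ, SphereModel m) 𝓘(ℝ, SphereModel m)
      (SphereBundle.coordChart x₀ L) q :=
    mdifferentiableAt_atlas (SphereBundle.coordChart_mem_atlas x₀ L) hq
  have h2 : (SphereBundle.coordChart x₀ L q).1 ∈ (chartAt (BaseModel m) x₀).target := by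
    rw [SphereBundle.coordChart_fst]
    exact (chartAt (BaseModel m) x₀).map_source (SphereBundle.proj_mem_source hq)
  have h3 := ((F.contDiffAt_unitLiftInCoord x₀ L h2).differentiableAt (by simp)).hasFDerivAt
  have h4 := (h3.hasMFDerivAt.comp q h1.hasMFDerivAt).congr_of_eventuallyEq
    (f₁ := F.unitLift x₀) (by
      filter_upwards [(SphereBundle.coordChart x₀ L).open_source.mem_nhds hq] with q' hq'
      exact F.unitLift_eq x₀ hq')
  rw [mvfderiv, h4.mfderiv]
  rfl

/-- The Sasaki metric is differentiable. -/
theorem mdifferentiableAt_sasaki (p : SphereBundle m M)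
    (Y Z : ∀ q : SphereBundle m M, TangentSpace 𝓘(ℝ, SphereModel m) q)
    (hY : MDifferentiableAt 𝓘(ℝ, SphereModel m) 𝓘(ℝ, SphereModel m).tangent (fun q =>
        (⟨q, Y q⟩ : TangentBundle 𝓘(ℝ, SphereModel m) (SphereBundle m M))) p)
    (hZ : MDifferentiableAt 𝓘(ℝ, SphereModel m) 𝓘(ℝ, SphereModel m).tangent (fun q =>
        (⟨q, Z q⟩ : TangentBundle 𝓘(ℝ, SphereModel m) (SphereBundle m M))) p) :
    MDifferentiableAt 𝓘(ℝ, SphereModel m) 𝓘(ℝ, ℝ) (fun q => F.sasaki q (Y q) (Z q)) p := by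
  obtain ⟨x₀, L, hL⟩ : chartAt (SphereModel m) p ∈ atlas (SphereModel m) (SphereBundle m M) :=
    chart_mem_atlas _ p
  have hp : p ∈ (SphereBundle.coordChart x₀ L).source := by
    rw [← hL]
    exact mem_chart_source _ p
  set c := SphereBundle.coordChart x₀ L with hc
  -- The components of a field in the chart `c` are its components in the trivialization at `p`,
  -- because `c` is the preferred chart at `p`.
  have hcoord : ∀ X : (∀ q : SphereBundle m M, TangentSpace 𝓘(ℝ, SphereModel m) q),
      MDifferentiableAt 𝓘(ℝ, SphereModel m) 𝓘(ℝ, SphereModel m).tangent (fun q =>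
        (⟨q, X q⟩ : TangentBundle 𝓘(ℝ, SphereModel m) (SphereBundle m M))) p →
      MDifferentiableAt 𝓘(ℝ, SphereModel m) 𝓘(ℝ, SphereModel m)
        (fun q => (mvfderiv 𝓘(ℝ, SphereModel m) c q (X q) : SphereModel m)) p := by
    intro X hX
    let t := trivializationAt (SphereModel m)
      (TangentSpace 𝓘(ℝ, SphereModel m) : SphereBundle m M → Type _) p
    have h1 := (t.mdifferentiableAt_section_iff 𝓘(ℝ, SphereModel m) X
      (FiberBundle.mem_baseSet_trivializationAt' p)).1 hX
    refine h1.congr_of_eventuallyEq ?_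
    filter_upwards [chart_source_mem_nhds (SphereModel m) p] with q hq
    have hq' : q ∈ t.baseSet := by simpa [t] using hq
    have h2 := TangentBundle.continuousLinearMapAt_trivializationAt
      (I := 𝓘(ℝ, SphereModel m)) hq
    have h3 : mvfderiv 𝓘(ℝ, SphereModel m) c q (X q) = t.continuousLinearMapAt ℝ q (X q) := by
      rw [h2, ← hL]
      rfl
    rw [h3, t.continuousLinearMapAt_apply ℝ, t.coe_linearMapAt_of_mem (R := ℝ) hq']
  have h1 : MDifferentiableAt 𝓘(ℝ, SphereModel m) 𝓘(ℝ, SphereModel m) c p :=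
    mdifferentiableAt_atlas (SphereBundle.coordChart_mem_atlas x₀ L) hp
  have hx : (c p).1 ∈ (chartAt (BaseModel m) x₀).target := by
    rw [hc, SphereBundle.coordChart_fst]
    exact (chartAt (BaseModel m) x₀).map_source (SphereBundle.proj_mem_source hp)
  have hs := F.contDiffAt_unitLiftInCoord x₀ L hx
  have hs' : ContDiffAt ℝ ∞ (fderiv ℝ (F.unitLiftInCoord x₀ L)) (c p) :=
    hs.fderiv_right (by simp)
  let a : SphereModel m × (SphereModel m × SphereModel m) := (c p,
    (mvfderiv 𝓘(ℝ, SphereModel m) c p (Y p), mvfderiv 𝓘(ℝ, SphereModel m) c p (Z p)))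
  -- The metric near `p` is this function of the chart coordinates and of the components of `Y` and
  -- `Z`; `sasaki_eq` allows the same `x₀` at all nearby points.
  have hΨ : ContDiffAt ℝ ∞ (fun w : SphereModel m × (SphereModel m × SphereModel m) =>
      sasakiLocal (F.inCoord x₀) (F.unitLiftInCoord x₀ L w.1).1 (F.unitLiftInCoord x₀ L w.1).2
        (fderiv ℝ (F.unitLiftInCoord x₀ L) w.1 w.2.1)
        (fderiv ℝ (F.unitLiftInCoord x₀ L) w.1 w.2.2)) a := by
    have e1 : ContDiffAt ℝ ∞ (fun w : SphereModel m × (SphereModel m × SphereModel m) =>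
      F.unitLiftInCoord x₀ L w.1) a := ContDiffAt.comp a (f := Prod.fst) hs contDiffAt_fst
    have e2 : ContDiffAt ℝ ∞ (fun w : SphereModel m × (SphereModel m × SphereModel m) =>
      fderiv ℝ (F.unitLiftInCoord x₀ L) w.1) a :=
      ContDiffAt.comp a (f := Prod.fst) hs' contDiffAt_fst
    have hy : (F.unitLiftInCoord x₀ L (c p)).2 ≠ 0 := by
      rw [← F.unitLift_eq x₀ hp]
      exact F.unitLift_snd_ne_zero x₀ (SphereBundle.proj_mem_source hp)
    exact ((F.isLocalFinsler x₀).contDiffAt_sasakiLocal (x := (F.unitLiftInCoord x₀ L (c p)).1)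
      hx hy _ _).comp (f := fun w : SphereModel m × (SphereModel m × SphereModel m) =>
        (F.unitLiftInCoord x₀ L w.1, (fderiv ℝ (F.unitLiftInCoord x₀ L) w.1 w.2.1,
        fderiv ℝ (F.unitLiftInCoord x₀ L) w.1 w.2.2))) a
      (e1.prodMk ((e2.clm_apply (by fun_prop)).prodMk (e2.clm_apply (by fun_prop))))
  have h2 : MDifferentiableAt 𝓘(ℝ, SphereModel m)
      𝓘(ℝ, SphereModel m × (SphereModel m × SphereModel m)) (fun q => (c q,
        ((mvfderiv 𝓘(ℝ, SphereModel m) c q (Y q) : SphereModel m),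
          (mvfderiv 𝓘(ℝ, SphereModel m) c q (Z q) : SphereModel m)))) p :=
    h1.prodMk_space ((hcoord Y hY).prodMk_space (hcoord Z hZ))
  refine ((hΨ.differentiableAt (by simp)).mdifferentiableAt.comp p h2).congr_of_eventuallyEq ?_
  filter_upwards [c.open_source.mem_nhds hp] with q hq
  rw [F.sasaki_eq hq, F.mvfderiv_unitLift x₀ hq, F.mvfderiv_unitLift x₀ hq, F.unitLift_eq x₀ hq]
  rfl

end FinslerStructure

end ChartTransition

/-! ### The theorem for the Sasaki metric -/

theorem proposition2 (m : ℕ) {M : Type*} [TopologicalSpace M]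
    [ChartedSpace (BaseModel m) M] [IsManifold (𝓡 (m + 1)) ∞ M]
    [T2Space M] [SecondCountableTopology M]
    (F : FinslerStructure m M) (σ : M → ℝ) (hσ : ContMDiff (𝓡 (m + 1)) 𝓘(ℝ, ℝ) ∞ σ)
    (H H' : ∀ p : SphereBundle m M, TangentSpace 𝓘(ℝ, SphereModel m) p →ₗ[ℝ]
      TangentSpace 𝓘(ℝ, SphereModel m) p →ₗ[ℝ] TangentSpace 𝓘(ℝ, SphereModel m) p)
    (hH : IsCartanEndomorphism F.sasaki SphereBundle.vertical H)
    (hH' : IsCartanEndomorphism (conformal F.sasaki (fun p => σ p.proj))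
      SphereBundle.vertical H') :
    H' = H := by
  have hσd : ∀ p : SphereBundle m M, MDifferentiableAt (𝓡 (m + 1)) 𝓘(ℝ, ℝ) σ p.proj :=
    fun p => (hσ p.proj).mdifferentiableAt (by simp)
  refine hH.conformal_eq F.isDefiniteMetric_sasaki F.mdifferentiableAt_sasaki (fun p w hw => ?_)
    (fun p => (hσd p).comp p (SphereBundle.mdifferentiableAt_proj p)) (fun p v hv => ?_) hH'
  · obtain ⟨s, hs, hsV⟩ := SphereBundle.exists_frame_vertical p
    exact F.isDefiniteMetric_sasaki.exists_section_perp (F.mdifferentiableAt_sasaki p) s hs hsV hw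
  -- A function pulled back from the base is constant along the fibres: its differential factors
  -- through dπ, whose kernel is the vertical bundle.
  · have h := mvfderiv_comp_apply p (hσd p) (SphereBundle.mdifferentiableAt_proj p) v
    have hv' : mfderiv 𝓘(ℝ, SphereModel m) (𝓡 (m + 1))
      (SphereBundle.proj : SphereBundle m M → M) p v = 0 := hv
    rw [hv', map_zero] at h
    exact h
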